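/- Let $\Lambda_K=K[p_1,p_2,p_3,\dots]$ be the ring of symmetric functions in $\mathbf{x}=x_1,x_2,x_3,\dots$ over a field $K$ of characteristic $0$, where $p_k=x_1^k+x_2^k+\cdots$. Let $h_n=\sum_{\mu\vdash n}p_\mu/z_\mu$, and let $s_\mu$ denote the Schur functions. For $f,g\in\Lambda_{\mathbb{Q}(q)}$ let $f[g]$ be the plethysm: $f\mapsto f[g]$ is a $\mathbb{Q}(q)$-algebra homomorphism, $g\mapsto p_k[g]$ is a ring homomorphism, $p_k[p_j]=p_{kj}$, and $p_k[c(q)]=c(q^k)$ for $c\in\mathbb{Q}(q)$. Put $$H_n(\mathbf{x};q)=[n]_q!\,(1-q)^n\,h_n\!\left[\frac{p_1}{1-q}\right],\qquad F_{a,b}(\mathbf{x};q)=\frac{H_b[H_a]-H_a[H_b]}{1-q},$$ where $[n]_q!=\prod_{k=1}^n(1+q+\dots+q^{k-1})$. Let $f\mapsto\overline{f}$ be the linear operator on $\Lambda_{\mathbb{Q}}$ that sends $s_\mu$ to $s_{\bar\mu}$, where $\bar\mu$ is the partition obtained from $\mu$ by removing (one copy of) its largest part, and let $\langle-,-\rangle$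 be the scalar product on $\Lambda_{\mathbb{Q}}$ for which the Schur functions are orthonormal. **Proposition 3.3.** For all integers $0<a<b$, no coefficient of $F_{a,b}(\mathbf{x};q)$ or of $F_{a,b+1}(\mathbf{x};q)$ (as polynomials in the $p_k$) has a pole at $q=1$, so that $F_{a,b}(\mathbf{x};1)$ and $F_{a,b+1}(\mathbf{x};1)$ are defined; and for every partition $\lambda$, $$\big\langle\,\overline{F_{a,b+1}(\mathbf{x};1)}-\overline{F_{a,b}(\mathbf{x};1)},\;s_\lambda(\mathbf{x})\,\big\rangle\in\mathbb{N}=\{0,1,2,\dots\}.$$ -/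

import Mathlib

open MvPolynomial

noncomputable section

namespace SymmFun

/-- The ring `Λ_K` of symmetric functions in the denumerable set of variables `x₁, x₂, x₃, …`, over
a field `K` of characteristic zero.  The power sums `p_k = x₁^k + x₂^k + ⋯` (`k ≥ 1`) are
algebraically independent and generate it, so it is the polynomial ring `K[p₁, p₂, p₃, …]`. -/
abbrev Sym (K : Type) [Field K] : Type := MvPolynomial ℕ+ K

section Basic

variable (K : Type) [Field K]

/-- The power sum `p_k`, for `k ≥ 1`.  (The value at `k = 0` is never used.) -/
def p (k : ℕ) : Sym K := X k.toPNat'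

/-- `z_μ = ∏ j ^ d_j * d_j!`, where `d_j` is the multiplicity of the part `j` in `μ`. -/
def zee {n : ℕ} (μ : n.Partition) : ℕ :=
  ∏ j ∈ μ.parts.toFinset, j ^ μ.parts.count j * (μ.parts.count j).factorial

/-- The power sum product `p_μ = p_{μ₁} p_{μ₂} ⋯`. -/
def pPart {n : ℕ} (μ : n.Partition) : Sym K := (μ.parts.map (p K)).prod

/-- The complete homogeneous symmetric function `h_n = ∑_{μ ⊢ n} p_μ / z_μ`. -/
def h (n : ℕ) : Sym K := ∑ μ : n.Partition, C ((zee μ : K)⁻¹) * pPart K μ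

/-- `h_m` for an integer index, with `h_m = 0` for `m < 0`. -/
def hInt (m : ℤ) : Sym K := if 0 ≤ m then h K m.toNat else 0

/-- The Schur function `s_μ = det (h_{μ_i - i + j})` (Jacobi–Trudi), the determinant having as many
rows as `μ` has parts.  A partition is a Young diagram `μ`, its list of parts is `μ.rowLens`. -/
def schur (μ : YoungDiagram) : Sym K :=
  Matrix.det (Matrix.of fun i j : Fin μ.rowLens.length =>
    hInt K ((μ.rowLens.get i : ℤ) - (i : ℤ) + (j : ℤ)))

end Basic

/-! ### The Schur functions form a basis -/

section Schur

/-- The grading: `p_k` has degree `k`. -/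
abbrev wt : ℕ+ → ℕ := fun k => (k : ℕ)

theorem p_homog (K : Type) [Field K] {k : ℕ} (hk : 0 < k) : IsWeightedHomogeneous wt (p K k) k := by
  have := isWeightedHomogeneous_X K wt k.toPNat'
  have e : wt k.toPNat' = k := by simp [wt, Nat.toPNat'_coe, hk]
  rwa [e] at this

theorem multiset_homog (f : ℕ → Sym ℚ) (m : Multiset ℕ)
    (hf : ∀ k ∈ m, IsWeightedHomogeneous wt (f k) k) :
    IsWeightedHomogeneous wt (m.map f).prod m.sum := by
  induction m using Multiset.induction with
  | empty => simpa using isWeightedHomogeneous_one ℚ wt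
  | cons a m ih =>
    simp only [Multiset.map_cons, Multiset.prod_cons, Multiset.sum_cons]
    exact (hf a (by simp)).mul (ih fun k hk => hf k (by simp [hk]))

theorem h_homog (n : ℕ) : IsWeightedHomogeneous wt (h ℚ n) n := by
  unfold h
  refine IsWeightedHomogeneous.sum _ _ _ fun μ _ => IsWeightedHomogeneous.C_mul ?_ _
  have := multiset_homog (p ℚ) μ.parts fun k hk => p_homog ℚ (μ.parts_pos hk)
  rwa [μ.parts_sum] at this

theorem h_zero : h ℚ 0 = 1 := by
  unfold h
  rw [Fintype.sum_unique]
  simp [zee, pPart]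

theorem sum_get (L : List ℕ) : ∑ i, (L.get i : ℤ) = (L.sum : ℤ) := by
  rw [← Nat.cast_sum, ← List.sum_ofFn, List.ofFn_get]

theorem schur_homog (μ : YoungDiagram) :
    IsWeightedHomogeneous wt (schur ℚ μ) μ.rowLens.sum := by
  unfold schur
  rw [Matrix.det_apply']
  refine IsWeightedHomogeneous.sum _ _ _ fun σ _ => ?_
  have hs : ((Equiv.Perm.sign σ : ℤ) : Sym ℚ) = C ((Equiv.Perm.sign σ : ℤ) : ℚ) := by simp
  rw [hs]
  refine IsWeightedHomogeneous.C_mul ?_ _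
  simp only [Matrix.of_apply]
  by_cases hneg : ∃ i, (μ.rowLens.get (σ i) : ℤ) - ((σ i : ℕ) : ℤ) + ((i : ℕ) : ℤ) < 0
  · obtain ⟨i, hi⟩ := hneg
    rw [Finset.prod_eq_zero (Finset.mem_univ i) (by simp only [hInt]; rw [if_neg (by omega)])]
    exact isWeightedHomogeneous_zero _ _ _
  · push Not at hneg
    have key := IsWeightedHomogeneous.prod Finset.univ
      (fun i => hInt ℚ ((μ.rowLens.get (σ i) : ℤ) - ((σ i : ℕ) : ℤ) + ((i : ℕ) : ℤ)))
      (fun i => ((μ.rowLens.get (σ i) : ℤ) - ((σ i : ℕ) : ℤ) + ((i : ℕ) : ℤ)).toNat)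
      (w := wt) (fun i _ => by
        simp only [hInt]; rw [if_pos (hneg i)]; exact h_homog _)
    convert key using 1
    apply Nat.cast_injective (R := ℤ)
    rw [Nat.cast_sum, Finset.sum_congr rfl fun i _ => Int.toNat_of_nonneg (hneg i)]
    rw [Finset.sum_add_distrib, Finset.sum_sub_distrib,
      Equiv.sum_comp σ fun i => (μ.rowLens.get i : ℤ), Equiv.sum_comp σ fun i => ((i : ℕ) : ℤ)]
    simp only [sub_add_cancel]
    exact (sum_get _).symm

/-- Off the identity, the exponents in a Jacobi–Trudi determinant have a larger sum of squares. -/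
theorem sq_sum_lt {l : ℕ} (f : Fin l → ℤ) (hf : Antitone f) (σ : Equiv.Perm (Fin l)) (hσ : σ ≠ 1) :
    ∑ i, f i ^ 2 < ∑ i, (f (σ i) - ((σ i : ℕ) : ℤ) + ((i : ℕ) : ℤ)) ^ 2 := by
  have hanti : Antivary f (fun i : Fin l => ((i : ℕ) : ℤ)) := by
    intro i j hij
    exact hf (by simp only [Nat.cast_lt] at hij; exact hij.le)
  have h1 := hanti.sum_mul_le_sum_comp_perm_mul (σ := σ)
  have h2 : ∑ i, f i * ((i : ℕ) : ℤ) = ∑ i, f (σ i) * ((σ i : ℕ) : ℤ) :=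
    (Equiv.sum_comp σ fun i => f i * ((i : ℕ) : ℤ)).symm
  have h3 : ∑ i, f i ^ 2 = ∑ i, f (σ i) ^ 2 := (Equiv.sum_comp σ fun i => f i ^ 2).symm
  have h4 : 0 < ∑ i : Fin l, (((i : ℕ) : ℤ) - ((σ i : ℕ) : ℤ)) ^ 2 := by
    obtain ⟨i, hi⟩ : ∃ i, σ i ≠ i := by
      by_contra! hc
      exact hσ (Equiv.ext hc)
    refine Finset.sum_pos' (fun i _ => sq_nonneg _) ⟨i, Finset.mem_univ _, ?_⟩
    have : ((i : ℕ) : ℤ) - ((σ i : ℕ) : ℤ) ≠ 0 := fun hc => hi (Fin.ext (by omega))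
    positivity
  have h5 : ∑ i, (f (σ i) - ((σ i : ℕ) : ℤ) + ((i : ℕ) : ℤ)) ^ 2 =
      ∑ i, f (σ i) ^ 2 + 2 * (∑ i, f (σ i) * ((i : ℕ) : ℤ) - ∑ i, f (σ i) * ((σ i : ℕ) : ℤ))
        + ∑ i : Fin l, (((i : ℕ) : ℤ) - ((σ i : ℕ) : ℤ)) ^ 2 := by
    rw [← Finset.sum_sub_distrib, Finset.mul_sum, ← Finset.sum_add_distrib,
      ← Finset.sum_add_distrib]
    exact Finset.sum_congr rfl fun i _ => by ring
  rw [h5, h3]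
  linarith

theorem sq_sum_le (m : Multiset ℕ) : (m.map (· ^ 2)).sum ≤ m.sum ^ 2 := by
  induction m using Multiset.induction with
  | empty => simp
  | cons a m ih => simp only [Multiset.map_cons, Multiset.sum_cons]; nlinarith [Nat.zero_le (a * m.sum)]

theorem hprod_mem_span (N : ℕ) : ∀ m : Multiset ℕ, m.sum ^ 2 - (m.map (· ^ 2)).sum < N →
    (m.map (h ℚ)).prod ∈ Submodule.span ℚ (Set.range (schur ℚ)) := by
  induction N with
  | zero => intro m hm; omega
  | succ N ih =>
    intro m hm
    -- the zeros do not matter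
    obtain ⟨m', hpos, hprod, hsum, hsq⟩ : ∃ m' : Multiset ℕ, (∀ x ∈ m', 0 < x) ∧
        (m'.map (h ℚ)).prod = (m.map (h ℚ)).prod ∧ m'.sum = m.sum ∧
        (m'.map (· ^ 2)).sum = (m.map (· ^ 2)).sum := by
      clear hm
      induction m using Multiset.induction with
      | empty => exact ⟨0, by simp⟩
      | cons a m ihm =>
        obtain ⟨m', h1, h2, h3, h4⟩ := ihm
        rcases Nat.eq_zero_or_pos a with rfl | ha
        · exact ⟨m', h1, by simp [h2, h_zero], by simp [h3], by simp [h4]⟩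
        · refine ⟨a ::ₘ m', ?_, by simp [h2], by simp [h3], by simp [h4]⟩
          intro x hx
          rcases Multiset.mem_cons.1 hx with rfl | hx
          · exact ha
          · exact h1 x hx
    rw [← hprod]
    rw [← hsum, ← hsq] at hm
    clear hprod hsum hsq
    obtain ⟨L, hL, hLs⟩ : ∃ L : List ℕ, (L : Multiset ℕ) = m' ∧ L.SortedGE :=
      ⟨m'.sort (· ≥ ·), by simp, (Multiset.pairwise_sort m' (· ≥ ·)).sortedGE⟩
    subst hL
    have hpos' : ∀ x ∈ L, 0 < x := fun x hx => hpos x (by simpa using hx)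
    set μ := YoungDiagram.ofRowLens L hLs with hμ
    have hrow : μ.rowLens = L := YoungDiagram.rowLens_ofRowLens_eq_self hpos'
    have hdet : schur ℚ μ = ∑ σ : Equiv.Perm (Fin L.length), ((Equiv.Perm.sign σ : ℤ) : Sym ℚ) *
        ∏ i, hInt ℚ ((L.get (σ i) : ℤ) - ((σ i : ℕ) : ℤ) + ((i : ℕ) : ℤ)) := by
      unfold schur
      rw [hrow, Matrix.det_apply']
      rfl
    have hid : ∏ i : Fin L.length, hInt ℚ ((L.get i : ℤ) - ((i : ℕ) : ℤ) + ((i : ℕ) : ℤ)) =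
        (Multiset.map (h ℚ) (L : Multiset ℕ)).prod := by
      simp only [sub_add_cancel, hInt, Int.natCast_nonneg, if_true, Int.toNat_natCast]
      rw [← List.prod_ofFn, Multiset.map_coe, Multiset.prod_coe]
      congr 1
      conv_rhs => rw [← List.ofFn_get L, List.map_ofFn]
      rfl
    rw [← Finset.add_sum_erase _ _ (Finset.mem_univ (1 : Equiv.Perm (Fin L.length)))] at hdet
    simp only [Equiv.Perm.sign_one, Units.val_one, Int.cast_one, one_mul,
      Equiv.Perm.coe_one, id_eq] at hdet
    rw [hid] at hdet
    rw [← sub_eq_iff_eq_add] at hdet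
    rw [← hdet]
    refine Submodule.sub_mem _ (Submodule.subset_span ⟨μ, rfl⟩) (Submodule.sum_mem _ ?_)
    intro σ hσ
    have hσ1 : σ ≠ 1 := Finset.ne_of_mem_erase hσ
    rw [show ((Equiv.Perm.sign σ : ℤ) : Sym ℚ) = C ((Equiv.Perm.sign σ : ℤ) : ℚ) by simp,
      C_mul']
    refine Submodule.smul_mem _ _ ?_
    by_cases hneg : ∃ i, (L.get (σ i) : ℤ) - ((σ i : ℕ) : ℤ) + ((i : ℕ) : ℤ) < 0
    · obtain ⟨i, hi⟩ := hneg
      rw [Finset.prod_eq_zero (Finset.mem_univ i) (by simp only [hInt]; rw [if_neg (by omega)])]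
      exact Submodule.zero_mem _
    · push Not at hneg
      set β : Fin L.length → ℕ :=
        fun i => ((L.get (σ i) : ℤ) - ((σ i : ℕ) : ℤ) + ((i : ℕ) : ℤ)).toNat with hβ
      have hβc : ∀ i, (β i : ℤ) = (L.get (σ i) : ℤ) - ((σ i : ℕ) : ℤ) + ((i : ℕ) : ℤ) :=
        fun i => Int.toNat_of_nonneg (hneg i)
      have hp : ∏ i, hInt ℚ ((L.get (σ i) : ℤ) - ((σ i : ℕ) : ℤ) + ((i : ℕ) : ℤ)) =
          ((Finset.univ.val.map β).map (h ℚ)).prod := by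
        rw [Multiset.map_map]
        refine Finset.prod_congr rfl fun i _ => ?_
        simp only [hInt]; rw [if_pos (hneg i)]; rfl
      rw [hp]
      apply ih
      have e1 : (Finset.univ.val.map β).sum = (L : Multiset ℕ).sum := by
        change ∑ i, β i = _
        apply Nat.cast_injective (R := ℤ)
        rw [Nat.cast_sum, Finset.sum_congr rfl fun i _ => hβc i, Finset.sum_add_distrib,
          Finset.sum_sub_distrib, Equiv.sum_comp σ fun i => (L.get i : ℤ),
          Equiv.sum_comp σ fun i => ((i : ℕ) : ℤ)]
        simp only [sub_add_cancel]
        rw [sum_get, Multiset.sum_coe]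
      have e2 : ((L : Multiset ℕ).map (· ^ 2)).sum < ((Finset.univ.val.map β).map (· ^ 2)).sum := by
        have := sq_sum_lt (fun i => (L.get i : ℤ))
          (fun i j hij => Nat.cast_le.2 (hLs.getElem_ge_getElem_of_le hij)) σ hσ1
        simp only [← hβc] at this
        have e3 : ((L : Multiset ℕ).map (· ^ 2)).sum = ∑ i : Fin L.length, L.get i ^ 2 := by
          rw [← List.sum_ofFn, Multiset.map_coe, Multiset.sum_coe]
          congr 1
          conv_lhs => rw [← List.ofFn_get L, List.map_ofFn]
          rfl
        rw [e3, Multiset.map_map]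
        change _ < ∑ i, (β i) ^ 2
        exact_mod_cast this
      have e4 := sq_sum_le (Finset.univ.val.map β)
      rw [e1] at e4 ⊢
      omega

theorem X_mem_adjoin (n : ℕ) : ∀ k : ℕ+, (k : ℕ) ≤ n →
    (X k : Sym ℚ) ∈ Algebra.adjoin ℚ (Set.range (h ℚ)) := by
  induction n with
  | zero => intro k hk; exact absurd k.pos (by omega)
  | succ n ih =>
    intro k hk
    set A := Algebra.adjoin ℚ (Set.range (h ℚ))
    have hmem : h ℚ k ∈ A := Algebra.subset_adjoin ⟨k, rfl⟩
    have hk0 : (k : ℕ) ≠ 0 := k.pos.ne'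
    have hsum : h ℚ k = C ((zee (Nat.Partition.indiscrete k) : ℚ)⁻¹) * pPart ℚ (Nat.Partition.indiscrete k) +
        ∑ μ ∈ Finset.univ.erase (Nat.Partition.indiscrete k), C ((zee μ : ℚ)⁻¹) * pPart ℚ μ :=
      (Finset.add_sum_erase _ _ (Finset.mem_univ _)).symm
    have hrest : ∑ μ ∈ Finset.univ.erase (Nat.Partition.indiscrete k),
        C ((zee μ : ℚ)⁻¹) * pPart ℚ μ ∈ A := by
      refine Subalgebra.sum_mem _ fun μ hμ => ?_
      rw [C_mul']
      refine Subalgebra.smul_mem _ ?_ _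
      refine Subalgebra.multiset_prod_mem _ fun x hx => ?_
      obtain ⟨j, hj, rfl⟩ := Multiset.mem_map.1 hx
      have hjpos : 0 < j := μ.parts_pos hj
      refine ih _ ?_
      rw [Nat.toPNat'_coe, if_pos hjpos]
      have hjk : j ≤ k := by
        have := Multiset.single_le_sum (fun x _ => Nat.zero_le x) j hj
        rwa [μ.parts_sum] at this
      have hne : j ≠ k := by
        rintro rfl
        apply Finset.ne_of_mem_erase hμ
        obtain ⟨t, ht⟩ := Multiset.exists_cons_of_mem hj
        have hs := μ.parts_sum
        rw [ht, Multiset.sum_cons] at hs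
        have ht0 : t = 0 := by
          refine Multiset.eq_zero_of_forall_notMem fun x hx => ?_
          have h1 : 0 < x := μ.parts_pos (by rw [ht]; simp [hx])
          have h2 := Multiset.single_le_sum (fun x _ => Nat.zero_le x) x hx
          omega
        apply Nat.Partition.ext
        rw [Nat.Partition.indiscrete_parts hk0, ht, ht0]
        rfl
      omega
    have hmain := Subalgebra.sub_mem _ hmem hrest
    rw [hsum, add_sub_cancel_right] at hmain
    have hz : zee (Nat.Partition.indiscrete k) = k := by
      simp [zee]
    have hpk : pPart ℚ (Nat.Partition.indiscrete k) = X k := by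
      simp [pPart, p]
    rw [hz, hpk, C_mul'] at hmain
    have := Subalgebra.smul_mem _ hmain (k : ℚ)
    rwa [smul_smul, mul_inv_cancel₀ (by exact_mod_cast hk0), one_smul] at this

theorem schur_span : ⊤ ≤ Submodule.span ℚ (Set.range (schur ℚ)) := by
  have hA : Algebra.adjoin ℚ (Set.range (h ℚ)) = ⊤ := by
    rw [eq_top_iff, ← MvPolynomial.adjoin_range_X]
    refine Algebra.adjoin_le ?_
    rintro _ ⟨k, rfl⟩
    exact X_mem_adjoin k k le_rfl
  have hs : Subalgebra.toSubmodule (Algebra.adjoin ℚ (Set.range (h ℚ))) = ⊤ := by rw [hA]; rfl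
  rw [← hs, Algebra.adjoin_eq_span, Submodule.span_le]
  intro x hx
  obtain ⟨s, hsm, rfl⟩ := Submonoid.exists_multiset_of_mem_closure hx
  obtain ⟨m, rfl⟩ : ∃ m : Multiset ℕ, m.map (h ℚ) = s := by
    clear hx
    induction s using Multiset.induction with
    | empty => exact ⟨0, by simp⟩
    | cons a s ih =>
      obtain ⟨m, rfl⟩ := ih fun y hy => hsm y (by simp [hy])
      obtain ⟨k, rfl⟩ := hsm a (by simp)
      exact ⟨k ::ₘ m, by simp⟩
  exact hprod_mem_span _ m (Nat.lt_succ_self _)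

/-- The exponent vector of `p_μ`. -/
def expo (μ : YoungDiagram) : ℕ+ →₀ ℕ :=
  Multiset.toFinsupp ((μ.rowLens : Multiset ℕ).map Nat.toPNat')

theorem expo_injective : Function.Injective expo := by
  intro μ ν hmn
  have h1 := Multiset.toFinsupp.injective hmn
  have h2 := congrArg (Multiset.map ((↑) : ℕ+ → ℕ)) h1
  have h3 : ∀ κ : YoungDiagram, Multiset.map ((↑) : ℕ+ → ℕ)
      ((κ.rowLens : Multiset ℕ).map Nat.toPNat') = κ.rowLens := by
    intro κ
    rw [Multiset.map_map]
    conv_rhs => rw [← Multiset.map_id (κ.rowLens : Multiset ℕ)]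
    refine Multiset.map_congr rfl fun x hx => ?_
    have := κ.pos_of_mem_rowLens x (by simpa using hx)
    simp [Nat.toPNat'_coe, this]
  rw [h3, h3] at h2
  have h4 : μ.rowLens = ν.rowLens :=
    (Multiset.coe_eq_coe.1 h2).eq_of_sortedGE μ.rowLens_sorted ν.rowLens_sorted
  apply YoungDiagram.equivListRowLens.injective
  exact Subtype.ext h4

theorem weight_expo (μ : YoungDiagram) : Finsupp.weight wt (expo μ) = μ.rowLens.sum := by
  unfold expo
  have : ∀ l : List ℕ, (∀ x ∈ l, 0 < x) → Finsupp.weight wt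
      (Multiset.toFinsupp ((l : Multiset ℕ).map Nat.toPNat')) = l.sum := by
    intro l
    induction l with
    | nil => simp
    | cons a l ih =>
      intro hl
      rw [← Multiset.cons_coe, Multiset.map_cons, ← Multiset.singleton_add, map_add, map_add,
        ih fun x hx => hl x (by simp [hx]), Multiset.toFinsupp_singleton, List.sum_cons]
      congr 1
      rw [Finsupp.weight_single]
      simp [wt, Nat.toPNat'_coe, hl a (by simp)]
  exact this _ μ.pos_of_mem_rowLens

theorem finite_weight (n : ℕ) : {d : ℕ+ →₀ ℕ | Finsupp.weight wt d = n}.Finite := by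
  refine Set.Finite.subset (s := ((fun m : Multiset ℕ => Multiset.toFinsupp
    (m.map Nat.toPNat')) '' (Set.range fun μ : n.Partition => μ.parts))) (Set.toFinite _) ?_
  intro d hd
  refine ⟨(Finsupp.toMultiset d).map ((↑) : ℕ+ → ℕ), ⟨⟨_, ?_, ?_⟩, rfl⟩, ?_⟩
  · intro i hi
    obtain ⟨k, _, rfl⟩ := Multiset.mem_map.1 hi
    exact k.pos
  · change (Multiset.map ((↑) : ℕ+ → ℕ) (Finsupp.toMultiset d)).sum = n
    have hd' : Finsupp.weight wt d = n := hd
    rw [← hd']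
    clear hd hd'
    induction d using Finsupp.induction_linear with
    | zero => simp
    | add f g hf hg => simp only [map_add, Multiset.map_add, Multiset.sum_add, hf, hg]
    | single a c =>
      rw [Finsupp.toMultiset_single, Multiset.map_nsmul, Multiset.sum_nsmul, Finsupp.weight_single,
        Multiset.map_singleton, Multiset.sum_singleton]
  · simp only [Multiset.map_map]
    have : (Nat.toPNat' ∘ ((↑) : ℕ+ → ℕ)) = id := by
      funext k; simp
    rw [this, Multiset.map_id]
    exact Finsupp.toMultiset_toFinsupp d

theorem schur_linearIndependent : LinearIndependent ℚ (schur ℚ) := by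
  classical
  have hdeg : ∀ n : ℕ, LinearIndependent ℚ
      (fun μ : {μ : YoungDiagram // μ.rowLens.sum = n} => schur ℚ μ.1) := by
    intro n
    set W := weightedHomogeneousSubmodule ℚ wt n
    have hfin : Finite {d : ℕ+ →₀ ℕ // Finsupp.weight wt d = n} := finite_weight n
    let g : {μ : YoungDiagram // μ.rowLens.sum = n} → {d : ℕ+ →₀ ℕ // Finsupp.weight wt d = n} :=
      fun μ => ⟨expo μ.1, by rw [weight_expo, μ.2]⟩
    have hg : Function.Injective g := fun μ ν hmn =>
      Subtype.ext (expo_injective (congrArg Subtype.val hmn))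
    have : Finite {μ : YoungDiagram // μ.rowLens.sum = n} := Finite.of_injective g hg
    let _ := Fintype.ofFinite {μ : YoungDiagram // μ.rowLens.sum = n}
    let _ := Fintype.ofFinite {d : ℕ+ →₀ ℕ // Finsupp.weight wt d = n}
    let b : {μ : YoungDiagram // μ.rowLens.sum = n} → W :=
      fun μ => ⟨schur ℚ μ.1, by have := schur_homog μ.1; rwa [μ.2] at this⟩
    have hspan : ⊤ ≤ Submodule.span ℚ (Set.range b) := by
      rintro ⟨x, hx⟩ -
      have hxs := schur_span (Submodule.mem_top (x := x))
      have hmap := Submodule.mem_map_of_mem (f := weightedHomogeneousComponent wt n) hxs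
      have hxx : weightedHomogeneousComponent wt n x = x :=
        IsWeightedHomogeneous.weightedHomogeneousComponent_same hx
      rw [hxx, Submodule.map_span] at hmap
      suffices hsub : x ∈ (Submodule.span ℚ (Set.range b)).map W.subtype by
        obtain ⟨y, hy, hyx⟩ := hsub
        rwa [show y = ⟨x, hx⟩ from Subtype.ext hyx] at hy
      rw [Submodule.map_span]
      refine (Submodule.span_le.2 ?_) hmap
      rintro _ ⟨_, ⟨μ, rfl⟩, rfl⟩
      by_cases hμ : μ.rowLens.sum = n
      · refine Submodule.subset_span ⟨_, ⟨⟨μ, hμ⟩, rfl⟩, ?_⟩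
        have := schur_homog μ
        rw [hμ] at this
        exact this.weightedHomogeneousComponent_same.symm
      · rw [(schur_homog μ).weightedHomogeneousComponent_ne n (fun hc => hμ hc.symm)]
        exact Submodule.zero_mem _
    have hrank : Module.finrank ℚ W = Fintype.card {d : ℕ+ →₀ ℕ // Finsupp.weight wt d = n} := by
      have hW : W = restrictSupport ℚ {d : ℕ+ →₀ ℕ | Finsupp.weight wt d = n} :=
        weightedHomogeneousSubmodule_eq_finsupp_supported ℚ wt n
      rw [hW]
      exact Module.finrank_eq_card_basis (basisRestrictSupport ℚ _)
    have hli := linearIndependent_of_top_le_span_of_card_le_finrank hspan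
      (by rw [hrank]; exact Fintype.card_le_of_injective g hg)
    exact hli.map' W.subtype W.ker_subtype
  rw [linearIndependent_iff']
  intro s c hc μ hμ
  set n := μ.rowLens.sum with hn
  have h1 := congrArg (weightedHomogeneousComponent wt n) hc
  rw [map_sum, map_zero] at h1
  have h2 : ∑ ν ∈ s.subtype (fun ν => ν.rowLens.sum = n), c ν.1 • schur ℚ ν.1 = 0 := by
    rw [← h1, Finset.sum_subtype_eq_sum_filter (f := fun ν => c ν • schur ℚ ν), Finset.sum_filter]
    refine Finset.sum_congr rfl fun ν _ => ?_
    rw [map_smul]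
    split_ifs with hν
    · have := schur_homog ν
      rw [hν] at this
      rw [this.weightedHomogeneousComponent_same]
    · rw [(schur_homog ν).weightedHomogeneousComponent_ne n (fun hc => hν hc.symm), smul_zero]
  exact (linearIndependent_iff'.1 (hdeg n)) _ (fun ν => c ν.1) h2 ⟨μ, rfl⟩ (by simpa using hμ)

/-- The basis of Schur functions of `Λ_ℚ`, indexed by all partitions. -/
def schurBasis : Module.Basis YoungDiagram ℚ (Sym ℚ) :=
  Module.Basis.mk schur_linearIndependent schur_span

/-- The usual scalar product on symmetric functions: the bilinear form for which the Schur
functions are orthonormal. -/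
def scalar (f g : Sym ℚ) : ℚ :=
  (schurBasis.repr f).sum fun μ c => c * schurBasis.repr g μ

/-- The partition obtained from `μ` by removing its largest part (one copy of it). -/
def removeLargest (μ : YoungDiagram) : YoungDiagram :=
  YoungDiagram.ofRowLens μ.rowLens.tail μ.rowLens_sorted.pairwise.tail.sortedGE

/-- The linear "bar" operator, `s_μ ↦ s_{μ̄}` with `μ̄ = removeLargest μ`. -/
def bar : Sym ℚ →ₗ[ℚ] Sym ℚ := schurBasis.constr ℚ fun μ => schur ℚ (removeLargest μ)

end Schur

/-! ### Plethysm and the Hall–Littlewood functions `H_n(x; q)` over `ℚ(q)` -/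

/-- The field `ℚ(q)`. -/
abbrev Kq : Type := RatFunc ℚ

/-- The indeterminate `q`. -/
abbrev q : Kq := RatFunc.X

/-- The field endomorphism `q ↦ q ^ k` of `ℚ(q)`. -/
def adamsCoeff (k : ℕ+) : Kq →+* Kq :=
  RatFunc.mapRingHom (Polynomial.expand ℚ (k : ℕ)).toRingHom
    (nonZeroDivisors_le_comap_nonZeroDivisors_of_injective _ (Polynomial.expand_injective k.pos))

/-- `g ↦ p_k[g]`, the ring endomorphism with `p_k[p_j] = p_{kj}` and `p_k[q] = q ^ k`. -/
def adams (k : ℕ+) : Sym Kq →+* Sym Kq :=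
  eval₂Hom (C.comp (adamsCoeff k)) fun j => X (k * j)

/-- Plethysm `f[g]`: for fixed `g`, it is the `ℚ(q)`-algebra homomorphism in `f` which sends `p_k`
to `p_k[g]`. -/
def plethysm (f g : Sym Kq) : Sym Kq := aeval (fun k => adams k g) f

/-- `[n]_q! = [1]_q [2]_q ⋯ [n]_q` with `[k]_q = 1 + q + ⋯ + q ^ (k - 1)`. -/
def qFactorial (n : ℕ) : Kq := ∏ k ∈ Finset.range n, ∑ i ∈ Finset.range (k + 1), q ^ i

/-- `H_n(x; q) = [n]_q! (1 - q)^n h_n[x / (1 - q)]`, where `x = p₁ = x₁ + x₂ + ⋯`. -/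
def H (n : ℕ) : Sym Kq :=
  C (qFactorial n * (1 - q) ^ n) * plethysm (h Kq n) (C (1 - q)⁻¹ * p Kq 1)

/-- `F_{a,b}(x; q) = (H_b[H_a] - H_a[H_b]) / (1 - q)`. -/
def F (a b : ℕ) : Sym Kq :=
  C (1 - q)⁻¹ * (plethysm (H b) (H a) - plethysm (H a) (H b))

/-- No coefficient of `f` has a pole at `q = 1`, so that `f` may be specialized at `q = 1`. -/
def RegularAtOne (f : Sym Kq) : Prop := ∀ d : ℕ+ →₀ ℕ, (coeff d f).denom.eval 1 ≠ 0

/-- The specialization `q = 1`, coefficient by coefficient (for `f` regular at `q = 1`). -/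
def atOne (f : Sym Kq) : Sym ℚ :=
  ∑ d ∈ f.support, monomial d (RatFunc.eval (RingHom.id ℚ) 1 (coeff d f))

end SymmFun

end

namespace SymmFun

/-! ### Determinants of complete homogeneous symmetric functions -/

/-! Modulo `(1 - q)^2`, only the partitions `1^n` and `2 1^(n-2)` contribute to `H_n`, and `H_n =
p_1^n + (1 - q) * n(n-1)/4 * (p_2 p_1^(n-2) - p_1^n) + ⋯` (`exists_H_eq`). The plethysms `H_b[H_a]`
and `H_a[H_b]` thus share the constant term `p_1^(ab)`. Hence `F_{a,b}` is regular at `q = 1`, and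
its value is the difference of the two first-order terms, an explicit polynomial in `p_1` and `p_2`
(`exists_F_eq`).

This formula gives `F_{a,b+1} = p_1^a F_{a,b} + t` at `q = 1` (`exists_FOne_succ`), where `4t` is a
power of `p_1` times a binary form in `p_1^2 = h_2 + e_2` and `p_2 = h_2 - e_2`, with `e_2 = h_1^2 -
h_2`. Rewritten in `e_2` and `h_2`, the form has coefficients that are nonnegative multiples of `4`
(`coeff_stepForm_nonneg`, `exists_stepForm_eq_four_mul`). By the Pieri rules, multiplication by
`h_1`, `h_2` or `e_2` preserves Schur positivity. So `t` is Schur positive, and so is `F_{a,b}` at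
`q = 1`, by induction on `b` from `F_{a,a} = 0`.

Lengthening the first row of `μ` does not change `μ̄`, so `bar (p_1 f) - bar f` is Schur positive
whenever `f` is (`bar_h_one_mul_sub_mem`). The difference in the theorem is `(bar (p_1^a F_{a,b}) -
bar F_{a,b}) + bar t`, a sum of two Schur-positive functions.

The Pieri rules are read off Jacobi–Trudi determinants: a sum over all shifts of one row index
equals the sum over all shifts of one column index (`sum_shiftDet`), and there almost all terms have
two equal columns. -/

theorem hInt_natCast (n : ℕ) : hInt ℚ (n : ℤ) = h ℚ n := by simp [hInt]

theorem hInt_of_neg {m : ℤ} (hm : m < 0) : hInt ℚ m = 0 := if_neg (by omega)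

theorem hInt_zero : hInt ℚ 0 = 1 := by simp [hInt, h_zero]

theorem hInt_one : hInt ℚ 1 = h ℚ 1 := hInt_natCast 1

theorem hInt_two : hInt ℚ 2 = h ℚ 2 := hInt_natCast 2

/-- The determinant of the matrix `h_{β_i + γ_j}`. -/
noncomputable def shiftDet {l : ℕ} (β γ : Fin l → ℤ) : Sym ℚ :=
  Matrix.det (Matrix.of fun i j => hInt ℚ (β i + γ j))

/-- The column indices `0, 1, …, l - 1`. -/
def stdCols (l : ℕ) : Fin l → ℤ := fun j => ((j : ℕ) : ℤ)

/-- By Cramer's rule the two sides are the traces of `N * adj M` and `adj M * N`. -/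
theorem sum_det_updateRow {n R : Type*} [Fintype n] [DecidableEq n] [CommRing R]
    (M N : Matrix n n R) :
    ∑ i, (M.updateRow i (N i)).det = ∑ j, (M.updateCol j (N.transpose j)).det := by
  have h1 : ∀ i, (M.updateRow i (N i)).det = (N * M.adjugate) i i := by
    intro i
    rw [← Matrix.cramer_transpose_apply, Matrix.cramer_eq_adjugate_mulVec,
      ← Matrix.adjugate_transpose, Matrix.mul_apply]
    simp only [Matrix.mulVec, dotProduct, Matrix.transpose_apply]
    exact Finset.sum_congr rfl fun j _ => mul_comm _ _
  have h2 : ∀ j, (M.updateCol j (N.transpose j)).det = (M.adjugate * N) j j := by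
    intro j
    rw [← Matrix.cramer_apply, Matrix.cramer_eq_adjugate_mulVec, Matrix.mul_apply]
    rfl
  simp only [h1, h2]
  exact Matrix.trace_mul_comm N M.adjugate

theorem sum_shiftDet {l : ℕ} (β γ : Fin l → ℤ) (k : ℤ) :
    ∑ i, shiftDet (β + Pi.single i k) γ = ∑ j, shiftDet β (γ + Pi.single j k) := by
  have key := sum_det_updateRow (Matrix.of fun i j => hInt ℚ (β i + γ j))
    (Matrix.of fun i j => hInt ℚ (β i + γ j + k))
  convert key using 2 with i _ j _
  · unfold shiftDet
    congr 1
    ext1 a b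
    rcases eq_or_ne a i with rfl | hne
    · simp [add_right_comm]
    · simp [hne]
  · unfold shiftDet
    congr 1
    ext1 a b
    rcases eq_or_ne b j with rfl | hne
    · simp [add_assoc]
    · simp [hne]

theorem shiftDet_of_row_eq {l : ℕ} {β γ : Fin l → ℤ} {i j : Fin l} (hij : i ≠ j)
    (h : β i = β j) : shiftDet β γ = 0 :=
  Matrix.det_zero_of_row_eq hij (by ext1 a; simp [h])

theorem shiftDet_of_col_eq {l : ℕ} {β γ : Fin l → ℤ} {i j : Fin l} (hij : i ≠ j)
    (h : γ i = γ j) : shiftDet β γ = 0 :=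
  Matrix.det_zero_of_column_eq hij (by intro a; simp [h])

theorem shiftDet_comp_swap {l : ℕ} {β γ : Fin l → ℤ} {i j : Fin l} (hij : i ≠ j) :
    shiftDet (β ∘ Equiv.swap i j) γ = - shiftDet β γ := by
  have key : shiftDet (β ∘ Equiv.swap i j) γ =
      ((Equiv.Perm.sign (Equiv.swap i j) : ℤ) : Sym ℚ) * shiftDet β γ :=
    Matrix.det_permute (Equiv.swap i j) (Matrix.of fun i j => hInt ℚ (β i + γ j))
  rw [key, Equiv.Perm.sign_swap hij]
  simp

/-- The lower left block vanishes: its indices are at most `-l + (l - 1) < 0`. -/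
theorem shiftDet_block (l m : ℕ) (β γ : Fin (l + m) → ℤ)
    (hβ : ∀ i : Fin m, β (Fin.natAdd l i) ≤ -l)
    (hγ : ∀ j : Fin l, γ (Fin.castAdd m j) = ((j : ℕ) : ℤ)) :
    shiftDet β γ = shiftDet (β ∘ Fin.castAdd m) (stdCols l) *
      shiftDet (β ∘ Fin.natAdd l) (γ ∘ Fin.natAdd l) := by
  unfold shiftDet
  rw [← Matrix.det_submatrix_equiv_self finSumFinEquiv, ← Matrix.det_fromBlocks_zero₂₁ _
    (Matrix.of fun (i : Fin l) (j : Fin m) =>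
      hInt ℚ (β (Fin.castAdd m i) + γ (Fin.natAdd l j))) _]
  congr 1
  ext1 i j
  rcases i with i | i <;> rcases j with j | j
  · simp [hγ, stdCols]
  · simp
  · have h1 := hβ i
    have h2 : hInt ℚ (β (Fin.natAdd l i) + ((j : ℕ) : ℤ)) = 0 := hInt_of_neg (by omega)
    simp [hγ, h2]
  · simp

theorem shiftDet_castSucc {l : ℕ} (β : Fin (l + 1) → ℤ) (hβ : β (Fin.last l) = -l) :
    shiftDet β (stdCols (l + 1)) = shiftDet (β ∘ Fin.castSucc) (stdCols l) := by
  rw [shiftDet_block l 1 β (stdCols (l + 1))]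
  · have : shiftDet (β ∘ Fin.natAdd l) (stdCols (l + 1) ∘ Fin.natAdd l : Fin 1 → ℤ) = 1 := by
      have e : (Fin.natAdd l 0 : Fin (l + 1)) = Fin.last l := rfl
      simp [shiftDet, e, hβ, stdCols, hInt_zero]
    rw [this, mul_one]
    rfl
  · intro i
    rw [Fin.eq_zero i]
    exact hβ.le
  · intro j; rfl

/-! ### Schur functions as determinants -/

/-- The strictly decreasing sequence `μ_i - i`, for `i < l`. -/
def betaSeq (μ : YoungDiagram) (l : ℕ) : Fin l → ℤ :=
  fun i => (μ.rowLen i : ℤ) - ((i : ℕ) : ℤ)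

theorem betaSeq_strictAnti (μ : YoungDiagram) (l : ℕ) : StrictAnti (betaSeq μ l) := by
  intro i j hij
  have h1 := μ.rowLen_anti i j hij.le
  have h2 : (i : ℕ) < j := hij
  simp only [betaSeq]
  omega

theorem rowLen_eq_zero (μ : YoungDiagram) {i : ℕ} (hi : μ.rowLens.length ≤ i) :
    μ.rowLen i = 0 := by
  rw [YoungDiagram.length_rowLens] at hi
  by_contra hne
  have h1 : (i, 0) ∈ μ := YoungDiagram.mem_iff_lt_rowLen.2 (by omega)
  have h2 := YoungDiagram.mem_iff_lt_colLen.1 h1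
  omega

theorem schur_eq_shiftDet (μ : YoungDiagram) (l : ℕ) (hl : μ.rowLens.length ≤ l) :
    schur ℚ μ = shiftDet (betaSeq μ l) (stdCols l) := by
  induction l, hl using Nat.le_induction with
  | base =>
    unfold schur shiftDet
    congr 1
    ext1 i j
    simp [betaSeq, stdCols]
  | succ l hl ih =>
    rw [ih, shiftDet_castSucc]
    · rfl
    · simp [betaSeq, rowLen_eq_zero μ hl]

theorem shiftDet_eq_schur_ofFn {l : ℕ} (m : Fin l → ℕ) (hm : ∀ i, 0 < m i)
    (hs : (List.ofFn m).SortedGE) :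
    shiftDet (fun i => (m i : ℤ) - ((i : ℕ) : ℤ)) (stdCols l) =
      schur ℚ (YoungDiagram.ofRowLens (List.ofFn m) hs) := by
  have hpos : ∀ x ∈ List.ofFn m, 0 < x := by
    intro x hx
    obtain ⟨i, rfl⟩ := (List.mem_ofFn' m x).1 hx
    exact hm i
  have hlen : (YoungDiagram.ofRowLens (List.ofFn m) hs).rowLens.length = l := by
    rw [YoungDiagram.rowLens_ofRowLens_eq_self hpos, List.length_ofFn]
  rw [schur_eq_shiftDet _ l hlen.le]
  congr 1
  funext i
  have := YoungDiagram.rowLen_ofRowLens (w := List.ofFn m) (hw := hs)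
    ⟨i, by rw [List.length_ofFn]; exact i.2⟩
  simp only [betaSeq]
  rw [this]
  simp

/-- The numbers `β_i + i` decrease weakly. If the last one is negative, the last row is zero; if it
is `0`, that row can be dropped; if it is positive, all of them are, and they form a partition. -/
theorem shiftDet_eq_zero_or_schur {l : ℕ} (β : Fin l → ℤ) (hβ : StrictAnti β) :
    shiftDet β (stdCols l) = 0 ∨ ∃ μ, shiftDet β (stdCols l) = schur ℚ μ := by
  have hanti : ∀ {l : ℕ} (β : Fin l → ℤ), StrictAnti β →
      Antitone fun i => β i + ((i : ℕ) : ℤ) := by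
    intro l β hβ i j hij
    obtain ⟨d, hd⟩ := Nat.exists_eq_add_of_le (show (i : ℕ) ≤ j from hij)
    have : ∀ (d : ℕ) (j : Fin l), (j : ℕ) = i + d → β j + ((j : ℕ) : ℤ) ≤ β i + ((i : ℕ) : ℤ) := by
      intro d
      induction d with
      | zero => intro j hj; rw [Fin.ext (a := j) (b := i) (by omega)]
      | succ d ih =>
        intro j hj
        have h1 := ih ⟨i + d, by omega⟩ rfl
        have h2 := hβ (show (⟨i + d, by omega⟩ : Fin l) < j by rw [Fin.lt_def]; simp; omega)
        simp only at h1
        omega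
    exact this d j hd
  have hposcase : ∀ {l : ℕ} (β : Fin l → ℤ), StrictAnti β → (∀ i, 0 < β i + ((i : ℕ) : ℤ)) →
      ∃ μ, shiftDet β (stdCols l) = schur ℚ μ := by
    intro l β hβ hp
    have hs : (List.ofFn fun i => (β i + ((i : ℕ) : ℤ)).toNat).SortedGE := by
      rw [List.sortedGE_ofFn_iff]
      exact fun i j hij => Int.toNat_le_toNat (hanti β hβ hij)
    refine ⟨YoungDiagram.ofRowLens _ hs, ?_⟩
    rw [← shiftDet_eq_schur_ofFn (fun i => (β i + ((i : ℕ) : ℤ)).toNat)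
      (fun i => by have := hp i; omega) hs]
    congr 1
    funext i
    have := hp i
    omega
  induction l with
  | zero => exact Or.inr (hposcase β hβ fun i => i.elim0)
  | succ l ih =>
    rcases lt_trichotomy (β (Fin.last l) + l) 0 with hneg | h0 | hpos
    · refine Or.inl (Matrix.det_eq_zero_of_row_eq_zero (Fin.last l) fun j => ?_)
      have : (j : ℕ) < l + 1 := j.2
      exact hInt_of_neg (by simp only [stdCols]; omega)
    · rw [shiftDet_castSucc β (by omega)]
      exact ih _ (hβ.comp_strictMono (Fin.strictMono_castSucc))
    · refine Or.inr (hposcase β hβ fun i => ?_)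
      have := hanti β hβ (Fin.le_last i)
      simp only [Fin.val_last] at this
      omega

/-! ### The cone of Schur-positive symmetric functions -/

/-- The symmetric functions whose expansion on Schur functions has coefficients in `ℕ`. -/
noncomputable def schurCone : AddSubmonoid (Sym ℚ) := AddSubmonoid.closure (Set.range (schur ℚ))

theorem schur_mem_schurCone (μ : YoungDiagram) : schur ℚ μ ∈ schurCone :=
  AddSubmonoid.subset_closure ⟨μ, rfl⟩

/-- A repeated entry of `β` gives two equal rows; otherwise `β` is strictly decreasing. -/
theorem shiftDet_mem_schurCone {l : ℕ} (β : Fin l → ℤ) (hβ : Antitone β) :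
    shiftDet β (stdCols l) ∈ schurCone := by
  by_cases hinj : Function.Injective β
  · rcases shiftDet_eq_zero_or_schur β (hβ.strictAnti_of_injective hinj) with h0 | ⟨μ, hμ⟩
    · rw [h0]; exact zero_mem _
    · rw [hμ]; exact schur_mem_schurCone μ
  · simp only [Function.Injective, not_forall] at hinj
    obtain ⟨i, j, hij, hne⟩ := hinj
    rw [shiftDet_of_row_eq hne hij]
    exact zero_mem _

/-! ### Pieri rules -/

section Pieri

variable {l : ℕ} (β : Fin (l + 2) → ℤ)

/-- The two last rows stand for two zero parts of a partition, room enough for adding two boxes.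
When only the two last columns are moved, the effect is a 2 × 2 determinant in front of the original
Schur function. -/
theorem shiftDet_two (hβ : ∀ i : Fin 2, β (Fin.natAdd l i) = -l - ((i : ℕ) : ℤ))
    (γ : Fin (l + 2) → ℤ) (hγ : ∀ j : Fin l, γ (Fin.castAdd 2 j) = ((j : ℕ) : ℤ)) (c d : ℤ)
    (hc : γ (Fin.natAdd l 0) = l + c) (hd : γ (Fin.natAdd l 1) = l + d) :
    shiftDet β γ = (hInt ℚ c * hInt ℚ (d - 1) - hInt ℚ d * hInt ℚ (c - 1)) *
      shiftDet (β ∘ Fin.castAdd 2) (stdCols l) := by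
  rw [shiftDet_block l 2 β γ (fun i => by rw [hβ]; omega) hγ, mul_comm]
  congr 1
  have h0 := hβ 0
  have h1 := hβ 1
  simp only [Fin.val_zero, Fin.val_one, Nat.cast_zero, Nat.cast_one] at h0 h1
  simp only [shiftDet, Matrix.det_fin_two, Matrix.of_apply, Function.comp_apply, h0, h1, hc, hd]
  rw [show -(l : ℤ) - 0 + (l + c) = c by ring, show -(l : ℤ) - 1 + (l + d) = d - 1 by ring,
    show -(l : ℤ) - 0 + (l + d) = d by ring, show -(l : ℤ) - 1 + (l + c) = c - 1 by ring]

theorem shiftDet_stdCols (hβ : ∀ i : Fin 2, β (Fin.natAdd l i) = -l - ((i : ℕ) : ℤ)) :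
    shiftDet β (stdCols (l + 2)) = shiftDet (β ∘ Fin.castAdd 2) (stdCols l) := by
  rw [shiftDet_two β hβ _ (fun j => rfl) 0 1 (by simp [stdCols]) (by simp [stdCols])]
  simp [hInt_zero, hInt_of_neg]

/-- The moved column coincides with column `j + c`, which exists because `j < l` and `c ≤ 2`. -/
theorem shiftDet_stdCols_add_single (j : Fin l) {c : ℤ} (hc : c = 1 ∨ c = 2) :
    shiftDet β (stdCols (l + 2) + Pi.single (Fin.castAdd 2 j) c) = 0 := by
  have hj := j.2
  obtain ⟨k, hk, hk2, rfl⟩ : ∃ k : ℕ, 0 < k ∧ k ≤ 2 ∧ c = k := by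
    rcases hc with rfl | rfl
    · exact ⟨1, by simp⟩
    · exact ⟨2, by simp⟩
  have hne : (Fin.castAdd 2 j) ≠ (⟨j + k, by omega⟩ : Fin (l + 2)) := by
    rw [Ne, Fin.ext_iff]; simp; omega
  refine shiftDet_of_col_eq hne ?_
  simp [stdCols, Pi.single_eq_of_ne hne.symm]

theorem sum_univ_add_two {M : Type*} [AddCommMonoid M] (f : Fin (l + 2) → M) :
    ∑ i, f i = ∑ i : Fin l, f (Fin.castAdd 2 i) + (f (Fin.natAdd l 0) + f (Fin.natAdd l 1)) := by
  rw [Fin.sum_univ_add, Fin.sum_univ_two]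

theorem val_ne_self (j : Fin l) : (j : ℕ) ≠ l := j.2.ne

theorem val_ne_succ (j : Fin l) : (j : ℕ) ≠ l + 1 := by omega

theorem sum_shiftDet_single_one (hβ : ∀ i : Fin 2, β (Fin.natAdd l i) = -l - ((i : ℕ) : ℤ)) :
    ∑ i, shiftDet (β + Pi.single i 1) (stdCols (l + 2)) =
      h ℚ 1 * shiftDet β (stdCols (l + 2)) := by
  rw [sum_shiftDet, sum_univ_add_two,
    Finset.sum_eq_zero fun j _ => shiftDet_stdCols_add_single β j (Or.inl rfl), zero_add,
    shiftDet_two β hβ (stdCols (l + 2) + Pi.single (Fin.natAdd l 0) 1) _ 1 1,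
    shiftDet_two β hβ (stdCols (l + 2) + Pi.single (Fin.natAdd l 1) 1) _ 0 2,
    shiftDet_stdCols β hβ]
  · simp [hInt_zero, hInt_one, hInt_of_neg]
  all_goals simp [stdCols, Fin.ext_iff, add_assoc, val_ne_self, val_ne_succ]

/-- The factor is `p_2`, so this is a Murnaghan–Nakayama rule. The two surviving columns contribute
`h_2 - h_1^2` and `h_2`. -/
theorem sum_shiftDet_single_two (hβ : ∀ i : Fin 2, β (Fin.natAdd l i) = -l - ((i : ℕ) : ℤ)) :
    ∑ i, shiftDet (β + Pi.single i 2) (stdCols (l + 2)) =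
      (2 * h ℚ 2 - h ℚ 1 ^ 2) * shiftDet β (stdCols (l + 2)) := by
  rw [sum_shiftDet, sum_univ_add_two,
    Finset.sum_eq_zero fun j _ => shiftDet_stdCols_add_single β j (Or.inr rfl), zero_add,
    shiftDet_two β hβ (stdCols (l + 2) + Pi.single (Fin.natAdd l 0) 2) _ 2 1,
    shiftDet_two β hβ (stdCols (l + 2) + Pi.single (Fin.natAdd l 1) 2) _ 0 3,
    shiftDet_stdCols β hβ]
  · simp only [hInt_zero, hInt_one, hInt_two, hInt_of_neg (show (0 - 1 : ℤ) < 0 by norm_num),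
      show (1 - 1 : ℤ) = 0 by norm_num, show (2 - 1 : ℤ) = 1 by norm_num,
      show (3 - 1 : ℤ) = 2 by norm_num]
    ring
  all_goals simp [stdCols, Fin.ext_iff, add_assoc, val_ne_self, val_ne_succ]

theorem shiftDet_stdCols_add_single_add_single (i : Fin l) (j : Fin (l + 2)) :
    shiftDet β (stdCols (l + 2) + Pi.single (Fin.castAdd 2 i) 1 + Pi.single j 1) = 0 := by
  have hi := i.2
  rcases eq_or_ne j (Fin.castAdd 2 i) with rfl | hne
  · rw [add_assoc, ← Pi.single_add]
    exact shiftDet_stdCols_add_single β i (Or.inr rfl)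
  by_cases hj : (j : ℕ) = i + 1
  -- Column `i + 1` moves out of the way of column `i`, but lands on column `i + 2`.
  · have hne2 : j ≠ (⟨i + 2, by omega⟩ : Fin (l + 2)) := by
      rw [Ne, Fin.ext_iff]; simp; omega
    refine shiftDet_of_col_eq hne2 ?_
    simp [stdCols, Fin.ext_iff, hj]
    ring
  · have hne2 : Fin.castAdd 2 i ≠ (⟨i + 1, by omega⟩ : Fin (l + 2)) := by
      rw [Ne, Fin.ext_iff]; simp
    refine shiftDet_of_col_eq hne2 ?_
    rw [Ne, Fin.ext_iff] at hne
    simp only [Fin.val_castAdd] at hne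
    simp [stdCols, Fin.ext_iff, Ne.symm hne, Ne.symm hj]

/-- Both shifts are transferred to the columns. The four surviving terms are `h_2 - h_1^2`, twice
`h_1^2 - h_2`, and `h_2`. -/
theorem sum_sum_shiftDet (hβ : ∀ i : Fin 2, β (Fin.natAdd l i) = -l - ((i : ℕ) : ℤ)) :
    ∑ i, ∑ j, shiftDet (β + Pi.single i 1 + Pi.single j 1) (stdCols (l + 2)) =
      h ℚ 1 ^ 2 * shiftDet β (stdCols (l + 2)) := by
  have h1 : ∀ i, ∑ j, shiftDet (β + Pi.single i 1 + Pi.single j 1) (stdCols (l + 2)) =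
      ∑ j, shiftDet (β + Pi.single i 1) (stdCols (l + 2) + Pi.single j 1) :=
    fun i => sum_shiftDet _ _ _
  have h2 : ∀ j, ∑ i, shiftDet (β + Pi.single i 1) (stdCols (l + 2) + Pi.single j 1) =
      ∑ i, shiftDet β (stdCols (l + 2) + Pi.single j 1 + Pi.single i 1) :=
    fun i => sum_shiftDet _ _ _
  have h3 : ∀ (i : Fin (l + 2)) (j : Fin l),
      shiftDet β (stdCols (l + 2) + Pi.single i 1 + Pi.single (Fin.castAdd 2 j) 1) = 0 := by
    intro i j
    rw [add_right_comm]
    exact shiftDet_stdCols_add_single_add_single β j i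
  rw [Finset.sum_congr rfl fun i _ => h1 i, Finset.sum_comm,
    Finset.sum_congr rfl fun j _ => h2 j, sum_univ_add_two,
    Finset.sum_eq_zero fun i _ => Finset.sum_eq_zero fun j _ =>
      shiftDet_stdCols_add_single_add_single β i j, zero_add,
    sum_univ_add_two, Finset.sum_eq_zero fun j _ => h3 _ j, sum_univ_add_two,
    Finset.sum_eq_zero fun j _ => h3 _ j,
    shiftDet_two β hβ (stdCols (l + 2) + Pi.single (Fin.natAdd l 0) 1 +
      Pi.single (Fin.natAdd l 0) 1) _ 2 1,
    shiftDet_two β hβ (stdCols (l + 2) + Pi.single (Fin.natAdd l 0) 1 +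
      Pi.single (Fin.natAdd l 1) 1) _ 1 2,
    shiftDet_two β hβ (stdCols (l + 2) + Pi.single (Fin.natAdd l 1) 1 +
      Pi.single (Fin.natAdd l 0) 1) _ 1 2,
    shiftDet_two β hβ (stdCols (l + 2) + Pi.single (Fin.natAdd l 1) 1 +
      Pi.single (Fin.natAdd l 1) 1) _ 0 3,
    shiftDet_stdCols β hβ]
  · simp only [hInt_zero, hInt_one, hInt_two, hInt_of_neg (show (0 - 1 : ℤ) < 0 by norm_num),
      show (1 - 1 : ℤ) = 0 by norm_num, show (2 - 1 : ℤ) = 1 by norm_num,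
      show (3 - 1 : ℤ) = 2 by norm_num]
    ring
  all_goals simp [stdCols, Fin.ext_iff, add_assoc, val_ne_self, val_ne_succ]

end Pieri

/-! ### Closure properties of the Schur-positive cone -/

theorem betaSeq_natAdd (μ : YoungDiagram) (i : Fin 2) :
    betaSeq μ (μ.rowLens.length + 2) (Fin.natAdd μ.rowLens.length i) =
      -(μ.rowLens.length : ℤ) - ((i : ℕ) : ℤ) := by
  simp only [betaSeq, Fin.val_natAdd]
  rw [rowLen_eq_zero μ (by omega)]
  push_cast
  ring

theorem antitone_add_of_strictAnti {l : ℕ} {β δ : Fin l → ℤ} (hβ : StrictAnti β)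
    (hδ : ∀ i j, i < j → δ j ≤ δ i + 1) : Antitone (β + δ) := by
  intro i j hij
  rcases hij.eq_or_lt with rfl | hlt
  · exact le_rfl
  · have h1 := hβ hlt
    have h2 := hδ i j hlt
    simp only [Pi.add_apply]
    omega

theorem antitone_add_single {l : ℕ} {β : Fin l → ℤ} (hβ : StrictAnti β) (i : Fin l) :
    Antitone (β + Pi.single i 1) := by
  refine antitone_add_of_strictAnti hβ fun a b _ => ?_
  simp only [Pi.single_apply]
  split_ifs <;> omega

theorem antitone_add_single_add_single {l : ℕ} {β : Fin l → ℤ} (hβ : StrictAnti β) {i j : Fin l}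
    (hij : i ≠ j) : Antitone (β + Pi.single i 1 + Pi.single j 1) := by
  rw [add_assoc]
  refine antitone_add_of_strictAnti hβ fun a b _ => ?_
  simp only [Pi.add_apply, Pi.single_apply]
  split_ifs <;> omega

/-- Raising `β_j` by `2` breaks the order only by jumping over an entry equal to `β_j + 1`. -/
theorem antitone_add_single_two {l : ℕ} {β : Fin l → ℤ} (hβ : StrictAnti β) {j : Fin l}
    (hj : ∀ i, β i ≠ β j + 1) : Antitone (β + Pi.single j 2) := by
  intro a b hab
  rcases hab.eq_or_lt with rfl | hlt
  · exact le_rfl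
  · have h1 := hβ hlt
    simp only [Pi.add_apply, Pi.single_apply]
    by_cases hbj : b = j
    · subst hbj
      have h2 := hj a
      rw [if_pos rfl, if_neg hlt.ne]
      omega
    · rw [if_neg hbj]
      split_ifs <;> omega

/-- The entries `(β_j + 1, β_j + 2)` in rows `i`, `j` on the left are those on the right, exchanged.
-/
theorem shiftDet_add_single_two {l : ℕ} {β : Fin l → ℤ} {i j : Fin l} (hij : β i = β j + 1)
    (γ : Fin l → ℤ) :
    shiftDet (β + Pi.single j 2) γ = - shiftDet (β + Pi.single i 1 + Pi.single j 1) γ := by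
  have hne : i ≠ j := by rintro rfl; omega
  rw [← shiftDet_comp_swap hne]
  congr 1
  funext a
  simp only [Function.comp_apply, Pi.add_apply, Pi.single_apply]
  rcases eq_or_ne a i with rfl | hai
  · simp [hne, hne.symm, hij]
  rcases eq_or_ne a j with rfl | haj
  · simp [hne, hij]
    ring
  · simp [Equiv.swap_apply_of_ne_of_ne hai haj, hai, haj]

theorem sum_offDiag_eq {n : ℕ} {M : Type*} [AddCommMonoid M] (f : Fin n → Fin n → M)
    (hf : ∀ i j, f i j = f j i) :
    ∑ i, ∑ j, f i j = ∑ i, f i i + 2 • ∑ x : Fin n × Fin n with x.1 < x.2, f x.1 x.2 := by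
  rw [← Finset.sum_product', Finset.univ_product_univ,
    ← Finset.sum_filter_add_sum_filter_not _ (fun x : Fin n × Fin n => x.1 = x.2),
    ← Finset.sum_filter_add_sum_filter_not (Finset.univ.filter fun x : Fin n × Fin n => ¬ x.1 = x.2)
      (fun x : Fin n × Fin n => x.1 < x.2), two_smul, Finset.filter_filter, Finset.filter_filter]
  congr 1
  · refine (Finset.sum_bij (fun i _ => (i, i)) ?_ ?_ ?_ ?_).symm
    · simp
    · simp
    · rintro ⟨a, b⟩ hx
      simp at hx
      exact ⟨a, by simp, by simp [hx]⟩
    · simp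
  · congr 1
    · refine Finset.sum_congr ?_ fun _ _ => rfl
      ext ⟨a, b⟩
      simp only [Finset.mem_filter, Finset.mem_univ, true_and]
      exact ⟨fun hx => hx.2, fun hx => ⟨hx.ne, hx⟩⟩
    · refine Finset.sum_bij (fun x _ => (x.2, x.1)) ?_ ?_ ?_ ?_
      · rintro ⟨a, b⟩ hx
        simp only [Finset.mem_filter, Finset.mem_univ, true_and] at hx ⊢
        exact lt_of_le_of_ne (not_lt.1 hx.2) (Ne.symm hx.1)
      · rintro ⟨a, b⟩ _ ⟨c, d⟩ _ hx
        simp only [Prod.mk.injEq] at hx ⊢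
        exact hx.symm
      · rintro ⟨a, b⟩ hx
        simp only [Finset.mem_filter, Finset.mem_univ, true_and] at hx
        refine ⟨(b, a), ?_, rfl⟩
        simp only [Finset.mem_filter, Finset.mem_univ, true_and]
        exact ⟨hx.ne', hx.not_gt⟩
      · rintro ⟨a, b⟩ _
        exact hf a b

theorem mul_mem_schurCone_of_schur {x : Sym ℚ} (hx : ∀ μ, x * schur ℚ μ ∈ schurCone) {f : Sym ℚ}
    (hf : f ∈ schurCone) : x * f ∈ schurCone := by
  induction hf using AddSubmonoid.closure_induction with
  | mem f hf => obtain ⟨μ, rfl⟩ := hf; exact hx μ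
  | zero => rw [mul_zero]; exact zero_mem _
  | add f g _ _ hf hg => rw [mul_add]; exact add_mem hf hg

theorem h_one_mul_schur (μ : YoungDiagram) :
    h ℚ 1 * schur ℚ μ = ∑ i, shiftDet (betaSeq μ (μ.rowLens.length + 2) + Pi.single i 1)
      (stdCols (μ.rowLens.length + 2)) := by
  rw [sum_shiftDet_single_one _ (betaSeq_natAdd μ), schur_eq_shiftDet μ _ (Nat.le_add_right _ 2)]

theorem h_one_mul_mem {f : Sym ℚ} (hf : f ∈ schurCone) : h ℚ 1 * f ∈ schurCone := by
  refine mul_mem_schurCone_of_schur (fun μ => ?_) hf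
  rw [h_one_mul_schur]
  exact sum_mem fun i _ => shiftDet_mem_schurCone _ (antitone_add_single (betaSeq_strictAnti _ _) i)

/-- From `2 e_2 = p_1^2 - p_2`: the diagonal of the double sum for `p_1^2 s_μ` is `p_2 s_μ`, and
every other pair of rows occurs twice. -/
theorem e_two_mul_schur (μ : YoungDiagram) :
    (h ℚ 1 ^ 2 - h ℚ 2) * schur ℚ μ =
      ∑ x : Fin (μ.rowLens.length + 2) × Fin (μ.rowLens.length + 2) with x.1 < x.2,
        shiftDet (betaSeq μ (μ.rowLens.length + 2) + Pi.single x.1 1 + Pi.single x.2 1)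
          (stdCols (μ.rowLens.length + 2)) := by
  have h1 := sum_sum_shiftDet _ (betaSeq_natAdd μ)
  rw [sum_offDiag_eq _ fun i j => by rw [add_right_comm]] at h1
  have h2 := sum_shiftDet_single_two _ (betaSeq_natAdd μ)
  have hd : ∀ i, betaSeq μ (μ.rowLens.length + 2) + Pi.single i 1 + Pi.single i 1 =
      betaSeq μ (μ.rowLens.length + 2) + Pi.single i 2 := by
    intro i
    rw [add_assoc, ← Pi.single_add]
    rfl
  rw [Finset.sum_congr rfl fun i _ => congrArg (shiftDet · _) (hd i), h2,
    ← schur_eq_shiftDet μ _ (Nat.le_add_right _ 2), nsmul_eq_mul] at h1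
  have h3 : (2 : Sym ℚ) ≠ 0 := two_ne_zero
  apply mul_left_cancel₀ h3
  push_cast at h1
  linear_combination -h1

theorem e_two_mul_mem {f : Sym ℚ} (hf : f ∈ schurCone) :
    (h ℚ 1 ^ 2 - h ℚ 2) * f ∈ schurCone := by
  refine mul_mem_schurCone_of_schur (fun μ => ?_) hf
  rw [e_two_mul_schur]
  refine sum_mem fun x hx => shiftDet_mem_schurCone _
    (antitone_add_single_add_single (betaSeq_strictAnti _ _) ?_)
  exact (Finset.mem_filter.1 hx).2.ne

/-- Here `h_2 = e_2 + p_2`. The terms of `p_2 s_μ` whose order is broken are the negatives of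
distinct terms of `e_2 s_μ`, so they cancel; all the terms left are Schur positive. -/
theorem h_two_mul_mem {f : Sym ℚ} (hf : f ∈ schurCone) : h ℚ 2 * f ∈ schurCone := by
  classical
  refine mul_mem_schurCone_of_schur (fun μ => ?_) hf
  set n := μ.rowLens.length + 2 with hn
  set β := betaSeq μ n with hβ
  have hanti : StrictAnti β := betaSeq_strictAnti _ _
  have h1 := e_two_mul_schur μ
  have h2 := sum_shiftDet_single_two _ (betaSeq_natAdd μ)
  rw [← schur_eq_shiftDet μ _ (Nat.le_add_right _ 2)] at h2
  rw [← hn, ← hβ] at h1 h2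
  rw [← Finset.sum_filter_add_sum_filter_not _ (fun j => ∃ i, β i = β j + 1)] at h2
  have h3 : ∑ j with (∃ i, β i = β j + 1), shiftDet (β + Pi.single j 2) (stdCols n) =
      - ∑ x : Fin n × Fin n with β x.1 = β x.2 + 1,
        shiftDet (β + Pi.single x.1 1 + Pi.single x.2 1) (stdCols n) := by
    rw [← Finset.sum_neg_distrib]
    symm
    refine Finset.sum_bij (fun x _ => x.2) ?_ ?_ ?_ ?_
    · rintro ⟨i, j⟩ hx
      simp only [Finset.mem_filter, Finset.mem_univ, true_and] at hx ⊢
      exact ⟨i, hx⟩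
    · rintro ⟨i, j⟩ hx ⟨i', j'⟩ hx' hj
      simp only [Finset.mem_filter, Finset.mem_univ, true_and] at hx hx' hj
      subst hj
      rw [hanti.injective (hx.trans hx'.symm)]
    · intro j hj
      simp only [Finset.mem_filter, Finset.mem_univ, true_and] at hj
      obtain ⟨i, hi⟩ := hj
      exact ⟨(i, j), by simpa using hi, rfl⟩
    · rintro ⟨i, j⟩ hx
      simp only [Finset.mem_filter, Finset.mem_univ, true_and] at hx
      exact (shiftDet_add_single_two hx _).symm
  have hsub : (Finset.univ.filter fun x : Fin n × Fin n => β x.1 = β x.2 + 1) ⊆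
      Finset.univ.filter fun x : Fin n × Fin n => x.1 < x.2 := by
    intro x hx
    simp only [Finset.mem_filter, Finset.mem_univ, true_and] at hx ⊢
    exact hanti.lt_iff_gt.1 (by omega)
  rw [← Finset.sum_sdiff hsub] at h1
  have h4 : h ℚ 2 * schur ℚ μ =
      ∑ x ∈ (Finset.univ.filter fun x : Fin n × Fin n => x.1 < x.2) \
        (Finset.univ.filter fun x : Fin n × Fin n => β x.1 = β x.2 + 1),
        shiftDet (β + Pi.single x.1 1 + Pi.single x.2 1) (stdCols n) +
      ∑ j with ¬ (∃ i, β i = β j + 1), shiftDet (β + Pi.single j 2) (stdCols n) := by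
    linear_combination h1 - h2 + h3
  rw [h4]
  refine add_mem (sum_mem fun x hx => ?_) (sum_mem fun j hj => ?_)
  · exact shiftDet_mem_schurCone _ (antitone_add_single_add_single hanti
      (Finset.mem_filter.1 (Finset.mem_sdiff.1 hx).1).2.ne)
  · refine shiftDet_mem_schurCone _ (antitone_add_single_two hanti fun i hi => ?_)
    exact (Finset.mem_filter.1 hj).2 ⟨i, hi⟩

theorem pow_mul_mem {x : Sym ℚ} (hx : ∀ f ∈ schurCone, x * f ∈ schurCone) (n : ℕ) :
    ∀ f ∈ schurCone, x ^ n * f ∈ schurCone := by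
  induction n with
  | zero => intro f hf; simpa using hf
  | succ n ih => intro f hf; rw [pow_succ, mul_assoc]; exact ih _ (hx f hf)

theorem one_mem_schurCone : (1 : Sym ℚ) ∈ schurCone := by
  have := shiftDet_mem_schurCone (l := 0) (fun i => i.elim0) (fun i => i.elim0)
  simpa [shiftDet] using this

/-! ### The bar operator -/

/-- The partition obtained by adding a box to the first row. -/
theorem exists_addFirstRow (μ : YoungDiagram) : ∃ ν : YoungDiagram,
    removeLargest ν = removeLargest μ ∧
      shiftDet (betaSeq μ (μ.rowLens.length + 2) + Pi.single 0 1)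
        (stdCols (μ.rowLens.length + 2)) = schur ℚ ν := by
  -- For the empty partition this is `[1]`, since `rowLen 0 = 0` and the tail is empty.
  set w : List ℕ := (μ.rowLen 0 + 1) :: μ.rowLens.tail with hw
  have hwpos : ∀ x ∈ w, 0 < x := by
    intro x hx
    rcases List.mem_cons.1 hx with rfl | hx
    · omega
    · exact μ.pos_of_mem_rowLens x (List.mem_of_mem_tail hx)
  have hget : ∀ (i : ℕ) (hi : i < w.length), w[i] = μ.rowLen i + if i = 0 then 1 else 0 := by
    intro i hi
    rcases i with _ | i
    · simp [hw]
    · simp [hw]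
  have hws : w.SortedGE := by
    rw [List.sortedGE_iff_getElem_ge_getElem_of_le]
    intro i j hi hj hij
    rw [hget, hget]
    have := μ.rowLen_anti j i hij
    split_ifs <;> omega
  have hlen : w.length ≤ μ.rowLens.length + 1 := by simp [hw]
  have hrow : (YoungDiagram.ofRowLens w hws).rowLens = w :=
    YoungDiagram.rowLens_ofRowLens_eq_self hwpos
  refine ⟨YoungDiagram.ofRowLens w hws, ?_, ?_⟩
  · have : ∀ (w₁ w₂ : List ℕ) (h₁ : w₁.SortedGE) (h₂ : w₂.SortedGE), w₁ = w₂ →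
        YoungDiagram.ofRowLens w₁ h₁ = YoungDiagram.ofRowLens w₂ h₂ := by
      rintro w₁ _ h₁ h₂ rfl; rfl
    exact this _ _ _ _ (by rw [hrow, hw, List.tail_cons])
  · rw [schur_eq_shiftDet _ (μ.rowLens.length + 2) (by rw [hrow]; omega)]
    congr 1
    funext i
    simp only [betaSeq, Pi.add_apply, Pi.single_apply, Fin.ext_iff, Fin.val_zero]
    by_cases hi : (i : ℕ) < w.length
    · have := YoungDiagram.rowLen_ofRowLens (w := w) (hw := hws) ⟨i, hi⟩
      simp only [Fin.getElem_fin] at this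
      rw [this, hget]
      push_cast
      split_ifs <;> ring
    · rw [rowLen_eq_zero (YoungDiagram.ofRowLens w hws) (by rw [hrow]; omega),
        rowLen_eq_zero μ (by simp [hw] at hi ⊢; omega), if_neg (by simp [hw] at hi; omega)]
      ring

theorem bar_schur (μ : YoungDiagram) : bar (schur ℚ μ) = schur ℚ (removeLargest μ) := by
  have : schurBasis μ = schur ℚ μ := Module.Basis.mk_apply _ _ μ
  rw [← this]
  exact Module.Basis.constr_basis _ _ _ _

theorem bar_mem_schurCone {f : Sym ℚ} (hf : f ∈ schurCone) : bar f ∈ schurCone := by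
  induction hf using AddSubmonoid.closure_induction with
  | mem f hf => obtain ⟨μ, rfl⟩ := hf; rw [bar_schur]; exact schur_mem_schurCone _
  | zero => rw [map_zero]; exact zero_mem _
  | add f g _ _ hf hg => rw [map_add]; exact add_mem hf hg

/-- In `h_1 s_μ`, the term with a box added to the first row has the same bar as `s_μ`; the other
terms are Schur positive. -/
theorem bar_h_one_mul_sub_mem {f : Sym ℚ} (hf : f ∈ schurCone) :
    bar (h ℚ 1 * f) - bar f ∈ schurCone := by
  induction hf using AddSubmonoid.closure_induction with
  | mem f hf =>
    obtain ⟨μ, rfl⟩ := hf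
    obtain ⟨ν, hν, hdet⟩ := exists_addFirstRow μ
    rw [h_one_mul_schur, ← Finset.add_sum_erase _ _ (Finset.mem_univ 0), hdet, map_add, bar_schur,
      bar_schur, hν, add_sub_cancel_left]
    exact bar_mem_schurCone (sum_mem fun i _ =>
      shiftDet_mem_schurCone _ (antitone_add_single (betaSeq_strictAnti _ _) i))
  | zero => simp
  | add f g _ _ hf hg =>
    rw [mul_add, map_add, map_add, add_sub_add_comm]
    exact add_mem hf hg

theorem bar_h_one_pow_mul_sub_mem (n : ℕ) {f : Sym ℚ} (hf : f ∈ schurCone) :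
    bar (h ℚ 1 ^ n * f) - bar f ∈ schurCone := by
  induction n with
  | zero => simp
  | succ n ih =>
    rw [pow_succ', mul_assoc, ← sub_add_sub_cancel _ (bar (h ℚ 1 ^ n * f))]
    exact add_mem (bar_h_one_mul_sub_mem (pow_mul_mem (fun _ => h_one_mul_mem) n f hf)) ih

/-! ### Coefficients on the Schur basis -/

theorem exists_scalar_schur_eq {f : Sym ℚ} (hf : f ∈ schurCone) (lam : YoungDiagram) :
    ∃ n : ℕ, scalar f (schur ℚ lam) = n := by
  classical
  have hs : ∀ μ, schurBasis μ = schur ℚ μ := fun μ => Module.Basis.mk_apply _ _ μ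
  have hrepr : ∀ f, scalar f (schur ℚ lam) = schurBasis.repr f lam := by
    intro f
    rw [scalar, ← hs, Module.Basis.repr_self, Finsupp.sum]
    simp only [Finsupp.single_apply, mul_ite, mul_one, mul_zero]
    rw [Finset.sum_ite_eq]
    split_ifs with hmem
    · rfl
    · exact (Finsupp.notMem_support_iff.1 hmem).symm
  rw [hrepr]
  induction hf using AddSubmonoid.closure_induction with
  | mem f hf =>
    obtain ⟨μ, rfl⟩ := hf
    rw [← hs, Module.Basis.repr_self, Finsupp.single_apply]
    split_ifs
    · exact ⟨1, by simp⟩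
    · exact ⟨0, by simp⟩
  | zero => exact ⟨0, by simp⟩
  | add f g _ _ hf hg =>
    obtain ⟨m, hm⟩ := hf
    obtain ⟨n, hn⟩ := hg
    exact ⟨m + n, by rw [map_add, Finsupp.add_apply, hm, hn]; push_cast; rfl⟩

/-! ### A binary form with nonnegative coefficients -/

/-- Up to the factor `4` and a power of `p₁`, the difference `F_{a,b+1} - p₁ ^ a F_{a,b}` at
`q = 1`, for `a = r + 2` and `b = r + 2 + c`, as a form in `u = p₁ ^ 2` and `v = p₂`. -/
def stepForm {A : Type*} [CommRing A] (r c : ℕ) (u v : A) : A :=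
  (r + 1) * (r + 2 + 2 * c) * u ^ (r + c + 3) - (r + 2) * (r + 3 + 2 * c) * (v * u ^ (r + c + 2)) +
    2 * (r + c + 2) * (v ^ (r + 2) * u ^ (c + 1)) + (r + 2) * (r + 1) * ((u - v) * v ^ (r + c + 2))

theorem map_stepForm {A B : Type*} [CommRing A] [CommRing B] (f : A →+* B) (r c : ℕ) (u v : A) :
    f (stepForm r c u v) = stepForm r c (f u) (f v) := by
  simp [stepForm, map_ofNat f]

theorem coeff_one_sub_X_pow (n k : ℕ) :
    ((1 - Polynomial.X : Polynomial ℤ) ^ n).coeff k = (-1) ^ k * (n.choose k : ℤ) := by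
  have : (1 - Polynomial.X : Polynomial ℤ) ^ n =
      ((1 + Polynomial.X : Polynomial ℤ) ^ n).comp (Polynomial.C (-1) * Polynomial.X) := by
    simp [sub_eq_add_neg]
  rw [this, Polynomial.comp_C_mul_X_coeff, Polynomial.coeff_one_add_X_pow, mul_comm]

theorem sum_choose_mul_choose (a m k : ℕ) :
    ∑ x ∈ Finset.HasAntidiagonal.antidiagonal k, (a.choose x.1 * m.choose x.2 : ℤ) = ((a + m).choose k : ℤ) := by
  rw [Nat.add_choose_eq]
  push_cast
  rfl

/-- Vandermonde's identity after the absorption `x * C(a+1, x) = (a+1) * C(a, x-1)`. -/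
theorem sum_mul_choose_mul_choose (a m k : ℕ) :
    ∑ x ∈ Finset.HasAntidiagonal.antidiagonal (k + 1), (x.1 : ℤ) * ((a + 1).choose x.1 * m.choose x.2) =
      (a + 1) * ((a + m).choose k : ℤ) := by
  rw [Finset.Nat.antidiagonal_succ, Finset.sum_cons, Finset.sum_map, ← sum_choose_mul_choose a m k,
    Finset.mul_sum]
  simp only [Nat.cast_zero, zero_mul, zero_add]
  refine Finset.sum_congr rfl fun x _ => ?_
  have := Nat.add_one_mul_choose_eq a x.1
  zify at this
  simp
  linear_combination -(m.choose x.2 : ℤ) * this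

theorem sum_mul_mul_choose_mul_choose (a m k : ℕ) :
    ∑ x ∈ Finset.HasAntidiagonal.antidiagonal (k + 2), (x.1 : ℤ) * (x.1 - 1) * ((a + 2).choose x.1 * m.choose x.2) =
      (a + 2) * (a + 1) * ((a + m).choose k : ℤ) := by
  rw [Finset.Nat.antidiagonal_succ, Finset.sum_cons, Finset.sum_map, mul_assoc (a + 2 : ℤ),
    ← sum_mul_choose_mul_choose a m k, Finset.mul_sum]
  simp only [Nat.cast_zero, zero_mul, zero_add]
  refine Finset.sum_congr rfl fun x _ => ?_
  have := Nat.add_one_mul_choose_eq (a + 1) x.1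
  zify at this
  simp
  linear_combination -(x.1 * m.choose x.2 : ℤ) * this

/-- Vandermonde's identity and its first moment are used backwards, to bring the pure powers of `1 +
X` under the same sum as the product `(1 - X)^(r+2) * (1 + X)^(c+1)`, where signs can be compared
term by term. -/
theorem coeff_stepForm (r c k : ℕ) :
    (stepForm r c (1 + Polynomial.X) (1 - Polynomial.X : Polynomial ℤ)).coeff (k + 1) =
      2 * (r + c + 2) * ∑ x ∈ Finset.HasAntidiagonal.antidiagonal (k + 1),
        ((-1) ^ x.1 - 1 + 2 * x.1 : ℤ) * ((r + 2).choose x.1 * (c + 1).choose x.2) -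
      2 * (r + 2) * (r + 1) * (1 - (-1) ^ k) * ((r + c + 2).choose k : ℤ) := by
  have hform : stepForm r c (1 + Polynomial.X) (1 - Polynomial.X : Polynomial ℤ) =
      Polynomial.C ((r + 1) * (r + 2 + 2 * c) : ℤ) * (1 + Polynomial.X) ^ (r + c + 3) -
      Polynomial.C ((r + 2) * (r + 3 + 2 * c) : ℤ) *
        ((1 + Polynomial.X) ^ (r + c + 2) - Polynomial.X * (1 + Polynomial.X) ^ (r + c + 2)) +
      Polynomial.C (2 * (r + c + 2) : ℤ) *
        ((1 - Polynomial.X) ^ (r + 2) * (1 + Polynomial.X) ^ (c + 1)) +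
      Polynomial.C (2 * ((r + 2) * (r + 1)) : ℤ) *
        (Polynomial.X * (1 - Polynomial.X) ^ (r + c + 2)) := by
    simp only [stepForm, map_mul, map_add, map_natCast, map_one, map_ofNat]
    ring
  have h0 := sum_choose_mul_choose (r + 2) (c + 1) (k + 1)
  have h1 := sum_mul_choose_mul_choose (r + 1) (c + 1) k
  have hp : ((r + c + 3).choose (k + 1) : ℤ) =
      (r + c + 2).choose k + (r + c + 2).choose (k + 1) := by
    exact_mod_cast Nat.choose_succ_succ (r + c + 2) k
  rw [show r + 2 + (c + 1) = r + c + 3 by ring] at h0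
  rw [show r + 1 + (c + 1) = r + c + 2 by ring] at h1
  simp only [add_assoc r 1 1, show 1 + 1 = 2 from rfl] at h1
  push_cast at h1
  rw [hform]
  simp only [Polynomial.coeff_add, Polynomial.coeff_sub, Polynomial.coeff_C_mul,
    Polynomial.coeff_X_mul, Polynomial.coeff_mul ((1 - Polynomial.X : Polynomial ℤ) ^ _), coeff_one_sub_X_pow,
    Polynomial.coeff_one_add_X_pow]
  simp only [add_mul (_ - 1 : ℤ), sub_mul ((-1 : ℤ) ^ _), one_mul, mul_assoc, Finset.sum_add_distrib,
    Finset.sum_sub_distrib, ← Finset.mul_sum, h0, h1]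
  rw [hp]
  ring

/-- In degree `k + 1` with `k` even, the subtracted binomial has coefficient `0` and `(-1)^x - 1 +
2x ≥ 0`. With `k` odd, the binomial is absorbed into the sum as a second factorial moment, after
which every term is again nonnegative. -/
theorem coeff_stepForm_nonneg (r c k : ℕ) :
    0 ≤ (stepForm r c (1 + Polynomial.X) (1 - Polynomial.X : Polynomial ℤ)).coeff k := by
  rcases k with _ | k
  · simp [stepForm, Polynomial.coeff_zero_eq_eval_zero]
    apply le_of_eq
    ring
  rw [coeff_stepForm]
  rcases Nat.even_or_odd k with hk | hk
  · rw [hk.neg_one_pow]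
    simp only [sub_self, mul_zero, zero_mul, sub_zero]
    refine mul_nonneg (by positivity) (Finset.sum_nonneg fun x _ => mul_nonneg ?_ (by positivity))
    rcases Nat.even_or_odd x.1 with hx | hx
    · rw [hx.neg_one_pow]
      omega
    · rw [hx.neg_one_pow]
      have := hx.pos
      omega
  · rw [hk.neg_one_pow]
    obtain ⟨j, rfl⟩ : ∃ j, k = j + 1 := ⟨k - 1, by have := hk.pos; omega⟩
    have hch := Nat.add_one_mul_choose_eq (r + c + 1) j
    zify at hch
    have hS := sum_mul_mul_choose_mul_choose r (c + 1) j
    -- The factor `j + 1` turns `C(r+c+2, j+1)` into `(r+c+2) * C(r+c+1, j)`, which the second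
    -- moment `hS` expresses as a sum. The new weight is `2x(j+2-x)` for `x` even and
    -- `2(x-1)(j+1-x)` for `x` odd.
    refine nonneg_of_mul_nonneg_right (a := ((j : ℤ) + 1)) ?_ (by positivity)
    have key : ((j : ℤ) + 1) * (2 * (r + c + 2) * ∑ x ∈ Finset.HasAntidiagonal.antidiagonal (j + 1 + 1),
        ((-1) ^ x.1 - 1 + 2 * x.1 : ℤ) * ((r + 2).choose x.1 * (c + 1).choose x.2) -
      2 * (r + 2) * (r + 1) * (1 - -1) * ((r + c + 2).choose (j + 1) : ℤ)) =
      2 * (r + c + 2) * ∑ x ∈ Finset.HasAntidiagonal.antidiagonal (j + 2),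
        (((j : ℤ) + 1) * ((-1) ^ x.1 - 1 + 2 * x.1) - 2 * (x.1 * (x.1 - 1))) *
          ((r + 2).choose x.1 * (c + 1).choose x.2) := by
      simp only [sub_mul _ _ (((r + 2).choose _ : ℤ) * _), Finset.sum_sub_distrib, mul_assoc (2 : ℤ),
        mul_assoc ((j : ℤ) + 1), ← Finset.mul_sum]
      rw [hS, show r + (c + 1) = r + c + 1 by ring]
      simp only [show j + 1 + 1 = j + 2 from rfl] at *
      linear_combination (4 * (r + 2) * (r + 1) : ℤ) * hch
    rw [key]
    refine mul_nonneg (by positivity) (Finset.sum_nonneg fun x hx => mul_nonneg ?_ (by positivity))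
    have hxk : x.1 ≤ j + 2 := by
      have := Finset.HasAntidiagonal.mem_antidiagonal.1 hx
      omega
    rcases Nat.even_or_odd x.1 with hx | hx
    · rw [hx.neg_one_pow]
      have : (0 : ℤ) ≤ 2 * (x.1 * (j + 2 - x.1)) := by
        have : (0 : ℤ) ≤ j + 2 - x.1 := by omega
        positivity
      linarith
    · rw [hx.neg_one_pow]
      have h1 : (1 : ℤ) ≤ x.1 := by exact_mod_cast hx.pos
      -- The top value `x = j + 2` is even, because `k = j + 1` is odd.
      have h2 : (x.1 : ℤ) ≤ j + 1 := by
        have : x.1 ≠ j + 2 := by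
          intro he
          rw [he] at hx
          obtain ⟨t, ht⟩ := hk
          obtain ⟨s, hs⟩ := hx
          omega
        omega
      nlinarith [mul_nonneg (sub_nonneg.2 h1) (sub_nonneg.2 h2)]

/-- Expand `(1 - x)^(r+2)` around `1 + x` with increment `-2x`: the quadratic remainder has the
factor `4`. What remains carries `2 * (r+2) * (r+1)`, and `(r+2) * (r+1)` is even. -/
theorem exists_stepForm_eq_four_mul (r c : ℕ) {A : Type*} [CommRing A] (x : A) :
    ∃ s, stepForm r c (1 + x) (1 - x) = 4 * s := by
  obtain ⟨y, hy⟩ := Polynomial.powAddExpansion (1 + x) (-2 * x) (r + 2)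
  obtain ⟨t, ht⟩ : ∃ t, (r + 2) * (r + 1) = 2 * t := by
    obtain ⟨t, ht⟩ := (Nat.even_mul_succ_self (r + 1))
    exact ⟨t, by linarith⟩
  have ht' : ((r : A) + 2) * (r + 1) = 2 * t := by exact_mod_cast congrArg (Nat.cast (R := A)) ht
  refine ⟨2 * (r + c + 2) * y * x ^ 2 * (1 + x) ^ (c + 1) + t * x * (1 - x) ^ (r + c + 2)
    - t * x * (1 + x) ^ (r + c + 2), ?_⟩
  rw [show 1 + x + -2 * x = 1 - x by ring] at hy
  unfold stepForm
  rw [hy]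
  push_cast
  linear_combination (2 * x * (1 - x) ^ (r + c + 2) - 2 * x * (1 + x) ^ (r + c + 2)) * ht'

theorem isHomogeneous_stepForm {σ : Type*} (r c : ℕ) {u v : MvPolynomial σ ℤ}
    (hu : u.IsHomogeneous 1) (hv : v.IsHomogeneous 1) :
    (stepForm r c u v).IsHomogeneous (r + c + 3) := by
  have hc : ∀ (k : ℕ) {f : MvPolynomial σ ℤ} {n : ℕ}, f.IsHomogeneous n →
      ((k : MvPolynomial σ ℤ) * f).IsHomogeneous n := by
    intro k f n hf
    have := hf.C_mul (k : ℤ)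
    rwa [map_natCast] at this
  have h1 := hc ((r + 1) * (r + 2 + 2 * c)) (hu.pow (r + c + 3))
  have h2 := hc ((r + 2) * (r + 3 + 2 * c)) (hv.mul (hu.pow (r + c + 2)))
  have h3 := hc (2 * (r + c + 2)) ((hv.pow (r + 2)).mul (hu.pow (c + 1)))
  have h4 := hc ((r + 2) * (r + 1)) ((hu.sub hv).mul (hv.pow (r + c + 2)))
  rw [show 1 * (r + c + 3) = r + c + 3 by ring] at h1
  rw [show 1 + 1 * (r + c + 2) = r + c + 3 by ring] at h2 h4
  rw [show 1 * (r + 2) + 1 * (c + 1) = r + c + 3 by ring] at h3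
  have := ((h1.sub h2).add h3).add h4
  push_cast at this
  exact this

/-- By homogeneity, the coefficients of the dehomogenized form at `y = 1` determine the binary form.
-/
theorem stepForm_eq_sum (r c : ℕ) {A : Type*} [CommRing A] (x y : A) :
    stepForm r c (y + x) (y - x) =
      ∑ k ∈ Finset.HasAntidiagonal.antidiagonal (r + c + 3),
        ((stepForm r c (1 + Polynomial.X) (1 - Polynomial.X : Polynomial ℤ)).coeff k.1 : A) *
          (x ^ k.1 * y ^ k.2) := by
  have hhom : (stepForm r c (X 1 + X 0) (X 1 - X 0 : MvPolynomial (Fin 2) ℤ)).IsHomogeneous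
      (r + c + 3) :=
    isHomogeneous_stepForm r c ((isHomogeneous_X ℤ 1).add (isHomogeneous_X ℤ 0))
      ((isHomogeneous_X ℤ 1).sub (isHomogeneous_X ℤ 0))
  have h1 := Polynomial.homogenize_eq_of_isHomogeneous
    (p := stepForm r c (1 + Polynomial.X) (1 - Polynomial.X : Polynomial ℤ)) hhom (by
      have := map_stepForm (aeval ![Polynomial.X, 1] :
        MvPolynomial (Fin 2) ℤ →ₐ[ℤ] Polynomial ℤ).toRingHom r c (X 1 + X 0) (X 1 - X 0)
      simpa using this)
  have h2 := congrArg (aeval ![x, y]) h1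
  have h3 := map_stepForm (aeval ![x, y] : MvPolynomial (Fin 2) ℤ →ₐ[ℤ] A).toRingHom r c
    (X 1 + X 0) (X 1 - X 0)
  simp only [AlgHom.toRingHom_eq_coe, RingHom.coe_coe, map_add, map_sub, aeval_X] at h3
  rw [h3] at h2
  simp only [Matrix.cons_val_one, Matrix.cons_val_zero] at h2
  rw [← h2, Polynomial.homogenize, map_sum]
  refine Finset.sum_congr rfl fun k _ => ?_
  rw [aeval_monomial, Finsupp.prod_fintype _ _ (by simp)]
  simp

theorem stepForm_mem_schurCone (r c : ℕ) :
    ∃ f ∈ schurCone, stepForm r c (h ℚ 1 ^ 2) (2 * h ℚ 2 - h ℚ 1 ^ 2) = 4 * f := by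
  obtain ⟨s, hs⟩ := exists_stepForm_eq_four_mul r c (Polynomial.X : Polynomial ℤ)
  have hcoeff : ∀ k, ∃ m : ℕ,
      (stepForm r c (1 + Polynomial.X) (1 - Polynomial.X : Polynomial ℤ)).coeff k = 4 * m := by
    intro k
    have h1 := coeff_stepForm_nonneg r c k
    have h2 : (4 * s : Polynomial ℤ).coeff k = 4 * s.coeff k := by
      rw [show (4 : Polynomial ℤ) = Polynomial.C 4 by simp, Polynomial.coeff_C_mul]
    rw [hs, h2] at h1 ⊢
    obtain ⟨m, hm⟩ := Int.eq_ofNat_of_zero_le (show 0 ≤ s.coeff k by omega)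
    exact ⟨m, by rw [hm]⟩
  choose m hm using hcoeff
  -- Here `x = e_2` and `y = h_2`, so that `y + x = p_1^2` and `y - x = p_2`.
  have key := stepForm_eq_sum r c (h ℚ 1 ^ 2 - h ℚ 2) (h ℚ 2)
  rw [show h ℚ 2 + (h ℚ 1 ^ 2 - h ℚ 2) = h ℚ 1 ^ 2 by ring,
    show h ℚ 2 - (h ℚ 1 ^ 2 - h ℚ 2) = 2 * h ℚ 2 - h ℚ 1 ^ 2 by ring] at key
  refine ⟨∑ k ∈ Finset.HasAntidiagonal.antidiagonal (r + c + 3),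
    m k.1 • ((h ℚ 1 ^ 2 - h ℚ 2) ^ k.1 * (h ℚ 2 ^ k.2 * 1)), sum_mem fun k _ => nsmul_mem ?_ _, ?_⟩
  · exact pow_mul_mem (fun _ => e_two_mul_mem) _ _
      (pow_mul_mem (fun _ => h_two_mul_mem) _ _ one_mem_schurCone)
  · rw [key, Finset.mul_sum]
    refine Finset.sum_congr rfl fun k _ => ?_
    rw [hm, nsmul_eq_mul]
    push_cast
    ring

/-! ### The specialization of `F_{a,b}` at `q = 1` -/

/-- The coefficient of `1 - q` in the expansion of `H_n` at `q = 1`. -/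
noncomputable def firstOrder (n : ℕ) (f g : Sym ℚ) : Sym ℚ :=
  -- The truncation of `n - 2` is harmless: the scalar factor vanishes for `n ≤ 1`.
  C ((n : ℚ) * (n - 1) / 4) * (g * f ^ (n - 2) - f ^ n)

/-- The coefficient of `1 - q` in the expansion of `H_b[H_a]` at `q = 1`. -/
noncomputable def firstOrderComp (b a : ℕ) (f g : Sym ℚ) : Sym ℚ :=
  b * f ^ (a * (b - 1)) * firstOrder a f g + firstOrder b (f ^ a) (g ^ a)

/-- The specialization at `q = 1` of `F_{a,b}`, in terms of `f = p₁` and `g = p₂`. -/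
noncomputable def FOne (a b : ℕ) (f g : Sym ℚ) : Sym ℚ :=
  firstOrderComp b a f g - firstOrderComp a b f g

theorem FOne_self (a : ℕ) (f g : Sym ℚ) : FOne a a f g = 0 := sub_self _

theorem FOne_one_left (b : ℕ) (f g : Sym ℚ) : FOne 1 b f g = 0 := by
  simp [FOne, firstOrderComp, firstOrder]

/-- The factor `4` clears the denominators of the first-order terms; the identity is then polynomial
in `f` and `g`. -/
theorem FOne_succ (r c : ℕ) (f g : Sym ℚ) :
    4 * FOne (r + 2) (r + 2 + c + 1) f g = 4 * (f ^ (r + 2) * FOne (r + 2) (r + 2 + c) f g) +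
      f ^ (r * (r + 2 + c + 1)) * stepForm r c (f ^ 2) g := by
  have h4 : ∀ x : ℚ, (4 : Sym ℚ) * C (x / 4) = C x := by
    intro x
    rw [← map_ofNat C 4, ← C_mul]
    congr 1
    ring
  have hfo : ∀ n f g, 4 * firstOrder n f g = (n : Sym ℚ) * (n - 1) * (g * f ^ (n - 2) - f ^ n) := by
    intro n f g
    rw [firstOrder, ← mul_assoc, h4]
    simp
  have hfc : ∀ b a f g, 4 * firstOrderComp b a f g =
      b * f ^ (a * (b - 1)) * ((a : Sym ℚ) * (a - 1) * (g * f ^ (a - 2) - f ^ a)) +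
      (b : Sym ℚ) * (b - 1) * (g ^ a * (f ^ a) ^ (b - 2) - (f ^ a) ^ b) := by
    intro b a f g
    rw [← hfo, ← hfo, firstOrderComp]
    ring
  have hF : ∀ a b f g, 4 * FOne a b f g = 4 * firstOrderComp b a f g - 4 * firstOrderComp a b f g :=
    fun a b f g => by rw [FOne, mul_sub]
  rw [mul_left_comm, hF, hF, hfc, hfc, hfc, hfc, stepForm]
  rw [show r + 2 + c + 1 - 2 = r + c + 1 by omega, show r + 2 + c - 2 = r + c by omega,
    show r + 2 - 2 = r by omega, show r + 2 + c + 1 - 1 = r + c + 2 by omega,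
    show r + 2 + c - 1 = r + c + 1 by omega, show r + 2 - 1 = r + 1 by omega]
  push_cast
  ring

/-! ### Schur positivity of the specialization -/

theorem exists_FOne_succ (a b : ℕ) (ha : 0 < a) (hab : a ≤ b) :
    ∃ t ∈ schurCone, FOne a (b + 1) (h ℚ 1) (2 * h ℚ 2 - h ℚ 1 ^ 2) =
      h ℚ 1 ^ a * FOne a b (h ℚ 1) (2 * h ℚ 2 - h ℚ 1 ^ 2) + t := by
  obtain rfl | ⟨r, rfl⟩ : a = 1 ∨ ∃ r, a = r + 2 := by
    rcases a with _ | _ | r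
    · omega
    · exact Or.inl rfl
    · exact Or.inr ⟨r, rfl⟩
  · exact ⟨0, zero_mem _, by simp [FOne_one_left]⟩
  · obtain ⟨c, rfl⟩ := Nat.exists_eq_add_of_le hab
    obtain ⟨t, ht, hst⟩ := stepForm_mem_schurCone r c
    refine ⟨h ℚ 1 ^ (r * (r + 2 + c + 1)) * t, pow_mul_mem (fun _ => h_one_mul_mem) _ _ ht, ?_⟩
    have h4 : (4 : Sym ℚ) ≠ 0 := OfNat.ofNat_ne_zero 4
    apply mul_left_cancel₀ h4
    rw [FOne_succ, hst]
    ring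

theorem FOne_mem_schurCone (a b : ℕ) (ha : 0 < a) (hab : a ≤ b) :
    FOne a b (h ℚ 1) (2 * h ℚ 2 - h ℚ 1 ^ 2) ∈ schurCone := by
  induction b, hab using Nat.le_induction with
  | base => rw [FOne_self]; exact zero_mem _
  | succ b hab ih =>
    obtain ⟨t, ht, he⟩ := exists_FOne_succ a b ha hab
    rw [he]
    exact add_mem (pow_mul_mem (fun _ => h_one_mul_mem) _ _ ih) ht

theorem bar_FOne_succ_sub_mem (a b : ℕ) (ha : 0 < a) (hab : a ≤ b) :
    bar (FOne a (b + 1) (h ℚ 1) (2 * h ℚ 2 - h ℚ 1 ^ 2)) -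
      bar (FOne a b (h ℚ 1) (2 * h ℚ 2 - h ℚ 1 ^ 2)) ∈ schurCone := by
  obtain ⟨t, ht, he⟩ := exists_FOne_succ a b ha hab
  rw [he, map_add, add_sub_right_comm]
  exact add_mem (bar_h_one_pow_mul_sub_mem a (FOne_mem_schurCone a b ha hab))
    (bar_mem_schurCone ht)

/-! ### Rational functions without pole at `q = 1` -/

/-- The ring of rational functions without pole at `q = 1`. -/
noncomputable def regularRing : Subring Kq where
  carrier := {x | x.denom.eval 1 ≠ 0}
  zero_mem' := by simp
  one_mem' := by simp
  add_mem' {x y} hx hy := by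
    intro h0
    have := Polynomial.eval_eq_zero_of_dvd_of_eval_eq_zero (RatFunc.denom_add_dvd x y) h0
    rw [Polynomial.eval_mul] at this
    exact mul_ne_zero hx hy this
  mul_mem' {x y} hx hy := by
    intro h0
    have := Polynomial.eval_eq_zero_of_dvd_of_eval_eq_zero (RatFunc.denom_mul_dvd x y) h0
    rw [Polynomial.eval_mul] at this
    exact mul_ne_zero hx hy this
  neg_mem' {x} hx := by
    intro h0
    have := Polynomial.eval_eq_zero_of_dvd_of_eval_eq_zero (RatFunc.denom_mul_dvd (-1) x)
      (by rwa [neg_one_mul])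
    rw [Polynomial.eval_mul] at this
    refine mul_ne_zero ?_ hx this
    rw [show (-1 : Kq) = RatFunc.C (-1) by simp, RatFunc.denom_C]
    simp

theorem div_mem_regularRing (f : Polynomial ℚ) {g : Polynomial ℚ} (hg : g.eval 1 ≠ 0) :
    algebraMap (Polynomial ℚ) Kq f / algebraMap (Polynomial ℚ) Kq g ∈ regularRing := fun h0 =>
  hg (Polynomial.eval_eq_zero_of_dvd_of_eval_eq_zero (RatFunc.denom_div_dvd f g) h0)

theorem algebraMap_mem_regularRing (f : Polynomial ℚ) :
    algebraMap (Polynomial ℚ) Kq f ∈ regularRing := by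
  have := div_mem_regularRing f (g := 1) (by simp)
  simpa using this

theorem q_mem_regularRing : q ∈ regularRing := by
  have := algebraMap_mem_regularRing Polynomial.X
  rwa [RatFunc.algebraMap_X] at this

theorem const_mem_regularRing (c : ℚ) : (RatFunc.C c : Kq) ∈ regularRing := by
  rw [← RatFunc.algebraMap_C]
  exact algebraMap_mem_regularRing (Polynomial.C c)

theorem one_sub_q_mem_regularRing : 1 - q ∈ regularRing :=
  sub_mem (one_mem _) q_mem_regularRing

theorem one_sub_q_ne_zero : (1 - q : Kq) ≠ 0 := by
  intro h0
  have h1 : algebraMap (Polynomial ℚ) Kq (1 - Polynomial.X) = 0 := by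
    rw [map_sub, map_one, RatFunc.algebraMap_X, h0]
  have h2 := RatFunc.algebraMap_injective ℚ (h1.trans (map_zero _).symm)
  have h3 := congrArg (Polynomial.eval 0) h2
  simp at h3

theorem adamsCoeff_algebraMap (k : ℕ+) (f : Polynomial ℚ) :
    adamsCoeff k (algebraMap (Polynomial ℚ) Kq f) =
      algebraMap (Polynomial ℚ) Kq (Polynomial.expand ℚ k f) := by
  have h1 := RatFunc.map_apply_div (Polynomial.expand ℚ (k : ℕ)).toRingHom
    (nonZeroDivisors_le_comap_nonZeroDivisors_of_injective _
      (Polynomial.expand_injective k.pos)) f 1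
  simp only [map_one, div_one] at h1
  exact h1

theorem adamsCoeff_q (k : ℕ+) : adamsCoeff k q = q ^ (k : ℕ) := by
  have := adamsCoeff_algebraMap k Polynomial.X
  rwa [Polynomial.expand_X, map_pow, RatFunc.algebraMap_X] at this

/-- The substitution `q ↦ q^k` fixes the point `q = 1`. -/
theorem adamsCoeff_mem_regularRing (k : ℕ+) {x : Kq} (hx : x ∈ regularRing) :
    adamsCoeff k x ∈ regularRing := by
  rw [← RatFunc.num_div_denom x, map_div₀]
  rw [adamsCoeff_algebraMap, adamsCoeff_algebraMap]
  refine div_mem_regularRing _ ?_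
  rw [Polynomial.expand_eval, one_pow]
  exact hx

theorem eval_add_one_sub_q_mul (c : ℚ) {y : Kq} (hy : y ∈ regularRing) :
    RatFunc.eval (RingHom.id ℚ) 1 (RatFunc.C c + (1 - q) * y) = c := by
  have hd : ∀ {x : Kq}, x ∈ regularRing → Polynomial.eval₂ (RingHom.id ℚ) 1 x.denom ≠ 0 :=
    fun hx => hx
  have he := one_sub_q_mem_regularRing
  rw [RatFunc.eval_add _ _ (hd (const_mem_regularRing c)) (hd (mul_mem he hy)),
    RatFunc.eval_mul _ _ (hd he) (hd hy)]
  have h1 : RatFunc.eval (RingHom.id ℚ) 1 (1 - q) = 0 := by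
    have : (1 - q : Kq) = algebraMap (Polynomial ℚ) Kq (1 - Polynomial.X) := by
      rw [map_sub, map_one, RatFunc.algebraMap_X]
    rw [this, RatFunc.eval_algebraMap]
    simp
  have h2 : RatFunc.eval (RingHom.id ℚ) 1 (RatFunc.C c) = c := RatFunc.eval_C _ _
  rw [h1, h2, zero_mul, add_zero]

/-! ### Symmetric functions without pole at `q = 1` -/

/-- The ring of symmetric functions whose coefficients have no pole at `q = 1`. -/
noncomputable def regularSym : Subring (Sym Kq) :=
  (MvPolynomial.map (σ := ℕ+) regularRing.subtype).range

theorem coeff_mem_regularRing {f : Sym Kq} (hf : f ∈ regularSym) (d : ℕ+ →₀ ℕ) :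
    coeff d f ∈ regularRing := by
  obtain ⟨g, rfl⟩ := hf
  rw [coeff_map]
  exact (coeff d g).2

theorem C_mem_regularSym {x : Kq} (hx : x ∈ regularRing) : (C x : Sym Kq) ∈ regularSym :=
  ⟨C ⟨x, hx⟩, by simp⟩

theorem X_mem_regularSym (k : ℕ+) : (X k : Sym Kq) ∈ regularSym := ⟨X k, by simp⟩

theorem eval₂Hom_mem_regularSym {φ : Kq →+* Sym Kq} {g : ℕ+ → Sym Kq}
    (hφ : ∀ x : Kq, x ∈ regularRing → φ x ∈ regularSym) (hg : ∀ k, g k ∈ regularSym) {f : Sym Kq}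
    (hf : f ∈ regularSym) : eval₂Hom φ g f ∈ regularSym := by
  obtain ⟨f, rfl⟩ := hf
  induction f using MvPolynomial.induction_on with
  | C x => simpa using hφ x x.2
  | add f₁ f₂ h₁ h₂ => rw [map_add, map_add]; exact add_mem h₁ h₂
  | mul_X f k hf =>
    rw [map_mul, map_mul]
    exact mul_mem hf (by simpa using hg k)

theorem adams_mem_regularSym (k : ℕ+) {f : Sym Kq} (hf : f ∈ regularSym) :
    adams k f ∈ regularSym :=
  eval₂Hom_mem_regularSym (φ := C.comp (adamsCoeff k))
    (fun _ hx => C_mem_regularSym (adamsCoeff_mem_regularRing k hx))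
    (fun j => X_mem_regularSym (k * j)) hf

theorem plethysm_mem_regularSym {f g : Sym Kq} (hf : f ∈ regularSym) (hg : g ∈ regularSym) :
    plethysm f g ∈ regularSym :=
  eval₂Hom_mem_regularSym (φ := C) (fun _ hx => C_mem_regularSym hx)
    (fun k => adams_mem_regularSym k hg) hf

/-- An expansion with a regular remainder yields both the regularity and the value at `q = 1`. -/
theorem regularAtOne_and_atOne_eq {f r : Sym Kq} {g : Sym ℚ} (hr : r ∈ regularSym)
    (hf : f = MvPolynomial.map (RatFunc.C) g + C (1 - q) * r) :
    RegularAtOne f ∧ atOne f = g := by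
  have hc : ∀ d, coeff d f = RatFunc.C (coeff d g) + (1 - q) * coeff d r := by
    intro d
    rw [hf, coeff_add, coeff_map, coeff_C_mul]
  constructor
  · intro d
    rw [hc]
    exact add_mem (const_mem_regularRing _)
      (mul_mem one_sub_q_mem_regularRing (coeff_mem_regularRing hr d))
  · ext d
    classical
    rw [atOne, coeff_sum]
    simp only [coeff_monomial]
    rw [Finset.sum_ite_eq']
    split_ifs with hd
    · rw [hc, eval_add_one_sub_q_mul _ (coeff_mem_regularRing hr d)]
    -- Outside the support of `f` the coefficient of `g` must also vanish, being the value of `0` at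
    -- `q = 1`.
    · rw [notMem_support_iff, hc] at hd
      rw [← eval_add_one_sub_q_mul (coeff d g) (coeff_mem_regularRing hr d), hd, RatFunc.eval_zero]

/-! ### Partitions with at most one part different from `1` -/

theorem eq_replicate_or_of_sum_le (s : Multiset ℕ) (hpos : ∀ x ∈ s, 0 < x)
    (hs : s.sum ≤ s.card + 1) :
    s = Multiset.replicate s.card 1 ∨ s = 2 ::ₘ Multiset.replicate (s.card - 1) 1 := by
  have hle : ∀ s : Multiset ℕ, (∀ x ∈ s, 0 < x) → s.card ≤ s.sum := by
    intro s hpos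
    have := Multiset.card_nsmul_le_sum (s := s) (a := 1) hpos
    simpa using this
  induction s using Multiset.induction with
  | empty => simp
  | cons a s ih =>
    have hpos' : ∀ x ∈ s, 0 < x := fun x hx => hpos x (Multiset.mem_cons_of_mem hx)
    have ha := hpos a (Multiset.mem_cons_self a s)
    have h1 := hle s hpos'
    simp only [Multiset.sum_cons, Multiset.card_cons] at hs
    rcases ih hpos' (by omega) with h | h
    · obtain rfl | rfl : a = 1 ∨ a = 2 := by omega
      · left
        rw [Multiset.card_cons, Multiset.replicate_succ, ← h]
      · right
        rw [Multiset.card_cons, Nat.add_sub_cancel, ← h]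
    · have hc : 0 < s.card := by rw [h]; simp
      have h2 : s.sum = s.card + 1 := by
        conv_lhs => rw [h]
        simp
        omega
      obtain rfl : a = 1 := by omega
      right
      rw [Multiset.card_cons, Nat.add_sub_cancel]
      conv_lhs => rw [h]
      rw [Multiset.cons_swap, ← Multiset.replicate_succ, Nat.sub_add_cancel hc]

/-- The partition `1 + 1 + ⋯ + 1`. -/
def onesPartition (n : ℕ) : n.Partition where
  parts := Multiset.replicate n 1
  parts_pos := by intro i hi; rw [Multiset.eq_of_mem_replicate hi]; exact one_pos
  parts_sum := by simp

/-- The partition `2 + 1 + ⋯ + 1`. -/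
def twoOnesPartition (n : ℕ) : (n + 2).Partition where
  parts := 2 ::ₘ Multiset.replicate n 1
  parts_pos := by
    intro i hi
    rcases Multiset.mem_cons.1 hi with rfl | hi
    · exact two_pos
    · rw [Multiset.eq_of_mem_replicate hi]; exact one_pos
  parts_sum := by simp [add_comm]

/-- This isolates the partitions of length at least `n + 1`; the others contribute to `H_(n+2)` with
a factor `(1 - q)^2`. -/
theorem sum_partition_add_two {M : Type*} [AddCommMonoid M] (n : ℕ) (f : (n + 2).Partition → M) :
    ∑ μ, f μ = f (onesPartition (n + 2)) + (f (twoOnesPartition n) +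
      ∑ μ with μ.parts.card ≤ n, f μ) := by
  classical
  have hne : onesPartition (n + 2) ≠ twoOnesPartition n := by
    intro h
    have := congrArg (fun μ => μ.parts.card) h
    simp [onesPartition, twoOnesPartition] at this
  rw [← Finset.add_sum_erase _ _ (Finset.mem_univ (onesPartition (n + 2))),
    ← Finset.add_sum_erase _ _ (Finset.mem_erase.2 ⟨hne.symm, Finset.mem_univ _⟩)]
  congr 2
  refine Finset.sum_congr ?_ fun _ _ => rfl
  ext μ
  simp only [Finset.mem_erase, Finset.mem_univ, and_true, Finset.mem_filter, true_and]
  constructor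
  · rintro ⟨h2, h1⟩
    by_contra hc
    rcases eq_replicate_or_of_sum_le μ.parts (fun x hx => μ.parts_pos hx)
      (by rw [μ.parts_sum]; omega) with h | h
    · refine h1 (Nat.Partition.ext ?_)
      have hs := congrArg Multiset.sum h
      rw [μ.parts_sum, Multiset.sum_replicate, smul_eq_mul, mul_one] at hs
      rw [h, ← hs]
      rfl
    · refine h2 (Nat.Partition.ext ?_)
      have hs := congrArg Multiset.sum h
      rw [μ.parts_sum, Multiset.sum_cons, Multiset.sum_replicate, smul_eq_mul, mul_one] at hs
      rw [h, show μ.parts.card - 1 = n by omega]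
      rfl
  · intro hc
    constructor
    · rintro rfl
      simp [twoOnesPartition] at hc
    · rintro rfl
      simp [onesPartition] at hc

theorem zee_onesPartition (n : ℕ) : zee (onesPartition n) = n.factorial := by
  unfold zee
  rw [Finset.prod_subset (s₂ := {1})]
  · simp [onesPartition]
  · intro x hx
    rw [Multiset.mem_toFinset] at hx
    simp [Multiset.eq_of_mem_replicate hx]
  · intro x _ hx
    rw [Multiset.mem_toFinset] at hx
    rw [Multiset.count_eq_zero_of_notMem hx]
    simp

theorem zee_twoOnesPartition (n : ℕ) : zee (twoOnesPartition n) = 2 * n.factorial := by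
  unfold zee
  rw [Finset.prod_subset (s₂ := {1, 2})]
  · simp [twoOnesPartition, Multiset.count_replicate, mul_comm]
  · intro x hx
    rw [Multiset.mem_toFinset] at hx
    rcases Multiset.mem_cons.1 (show x ∈ 2 ::ₘ Multiset.replicate n 1 from hx) with rfl | hx
    · simp
    · simp [Multiset.eq_of_mem_replicate hx]
  · intro x _ hx
    rw [Multiset.mem_toFinset] at hx
    rw [Multiset.count_eq_zero_of_notMem hx]
    simp

/-! ### The power sums of degrees 1 and 2 -/

theorem h_one : h ℚ 1 = p ℚ 1 := by
  have hz : onesPartition 1 = default := Subsingleton.elim _ _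
  rw [h, Fintype.sum_unique, ← hz, zee_onesPartition]
  simp [pPart, onesPartition]

theorem p_two : p ℚ 2 = 2 * h ℚ 2 - h ℚ 1 ^ 2 := by
  have h2 : h ℚ 2 = C (1 / 2) * p ℚ 1 ^ 2 + C (1 / 2) * p ℚ 2 := by
    rw [h, sum_partition_add_two 0, zee_onesPartition, zee_twoOnesPartition, Finset.sum_eq_zero]
    · simp [pPart, onesPartition, twoOnesPartition, sq]
    · intro μ hμ
      have h0 : μ.parts = 0 := by simpa using (Finset.mem_filter.1 hμ).2
      have := μ.parts_sum
      rw [h0] at this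
      simp at this
  have h3 : (2 : Sym ℚ) * C (1 / 2) = 1 := by
    rw [← map_ofNat C 2, ← C_mul]
    norm_num
  rw [h2, h_one]
  linear_combination (-p ℚ 1 ^ 2 - p ℚ 2) * h3

/-! ### Expansion of `H_n` at `q = 1` to the first order -/

/-- The `q`-integer `1 + q + ⋯ + q ^ (n - 1)`. -/
noncomputable def qInt (n : ℕ) : Kq := ∑ i ∈ Finset.range n, q ^ i

theorem qInt_mem_regularRing (n : ℕ) : qInt n ∈ regularRing :=
  sum_mem fun _ _ => pow_mem q_mem_regularRing _

theorem inv_qInt_mem_regularRing {n : ℕ} (hn : 0 < n) : (qInt n)⁻¹ ∈ regularRing := by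
  have h1 : qInt n = algebraMap (Polynomial ℚ) Kq (∑ i ∈ Finset.range n, Polynomial.X ^ i) := by
    simp [qInt, RatFunc.algebraMap_X]
  have h2 := div_mem_regularRing 1 (g := ∑ i ∈ Finset.range n, Polynomial.X ^ i) (by
    simp [Polynomial.eval_finsetSum]
    omega)
  rwa [← h1, map_one, one_div] at h2

theorem exists_q_pow_eq (n : ℕ) :
    ∃ y ∈ regularRing, q ^ n = 1 - n * (1 - q) + (1 - q) ^ 2 * y := by
  induction n with
  | zero => exact ⟨0, zero_mem _, by simp⟩
  | succ n ih =>
    obtain ⟨y, hy, h⟩ := ih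
    refine ⟨n + q * y, add_mem (natCast_mem _ n) (mul_mem q_mem_regularRing hy), ?_⟩
    rw [pow_succ, h]
    push_cast
    ring

theorem exists_qInt_eq (n : ℕ) :
    ∃ y ∈ regularRing, qInt n = n - n * (n - 1) / 2 * (1 - q) + (1 - q) ^ 2 * y := by
  induction n with
  | zero => exact ⟨0, zero_mem _, by simp [qInt]⟩
  | succ n ih =>
    obtain ⟨y, hy, h⟩ := ih
    obtain ⟨z, hz, h'⟩ := exists_q_pow_eq n
    refine ⟨y + z, add_mem hy hz, ?_⟩
    rw [qInt, Finset.sum_range_succ, ← qInt, h, h']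
    push_cast
    ring

theorem ratCast_mem_regularRing (c : ℚ) : (c : Kq) ∈ regularRing := by
  have := const_mem_regularRing c
  rwa [eq_ratCast] at this

/-- Since `[k]_q = k * (1 - (k-1)/2 * (1 - q) + ⋯)`, the first-order terms add up to `n(n-1)/4`. -/
theorem exists_qFactorial_eq (n : ℕ) : ∃ y ∈ regularRing,
    qFactorial n = n.factorial * (1 - n * (n - 1) / 4 * (1 - q)) + (1 - q) ^ 2 * y := by
  induction n with
  | zero => exact ⟨0, zero_mem _, by simp [qFactorial]⟩
  | succ n ih =>
    obtain ⟨y, hy, h⟩ := ih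
    obtain ⟨z, hz, h'⟩ := exists_qInt_eq (n + 1)
    refine ⟨y * qInt (n + 1) + n.factorial * (1 - n * (n - 1) / 4 * (1 - q)) * z +
      n.factorial * (n * (n - 1) / 4) * ((n + 1) * n / 2), ?_, ?_⟩
    · have h1 : ((n : Kq) * (n - 1) / 4) ∈ regularRing := by
        have := ratCast_mem_regularRing ((n : ℚ) * (n - 1) / 4)
        push_cast at this
        exact this
      have h2 : (((n : Kq) + 1) * n / 2) ∈ regularRing := by
        have := ratCast_mem_regularRing (((n : ℚ) + 1) * n / 2)
        push_cast at this
        exact this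
      exact add_mem (add_mem (mul_mem hy (qInt_mem_regularRing _))
        (mul_mem (mul_mem (natCast_mem _ _)
          (sub_mem (one_mem _) (mul_mem h1 one_sub_q_mem_regularRing))) hz))
        (mul_mem (mul_mem (natCast_mem _ _) h1) h2)
    · have h3 : qFactorial (n + 1) = qFactorial n * qInt (n + 1) := by
        rw [qFactorial, Finset.prod_range_succ, ← qFactorial, qInt]
      rw [h3, Nat.factorial_succ]
      push_cast at h' ⊢
      linear_combination qInt (n + 1) * h +
        (n.factorial * (1 - n * (n - 1) / 4 * (1 - q)) : Kq) * h'

theorem adams_inv_one_sub_q (k : ℕ) (hk : 0 < k) :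
    adams k.toPNat' (C (1 - q)⁻¹ * p Kq 1) = C (((1 - q) * qInt k)⁻¹) * p Kq k := by
  have hq : adamsCoeff k.toPNat' q = q ^ k := by
    rw [adamsCoeff_q, Nat.toPNat'_coe, if_pos hk]
  rw [qInt, mul_neg_geom_sum, adams, map_mul, eval₂Hom_C, p, eval₂Hom_X', RingHom.comp_apply,
    map_inv₀, map_sub, map_one, hq, p]
  congr 2
  exact mul_one _

/-- Since `p_k[p_1/(1-q)] = p_k/((1-q)[k]_q)`, each part of `μ` uses up one factor of `(1 - q)^n`.
-/
theorem H_eq_sum (n : ℕ) : H n = ∑ μ : n.Partition,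
    C (qFactorial n * (1 - q) ^ (n - μ.parts.card) * (zee μ : Kq)⁻¹ *
      (μ.parts.map fun i => (qInt i)⁻¹).prod) * pPart Kq μ := by
  rw [H, plethysm, h, map_sum, Finset.mul_sum]
  refine Finset.sum_congr rfl fun μ _ => ?_
  set φ : Sym Kq →ₐ[Kq] Sym Kq := aeval (fun k => adams k (C (1 - q)⁻¹ * p Kq 1)) with hφ
  have h1 : φ (pPart Kq μ) =
      C (((1 - q) ^ μ.parts.card)⁻¹ * (μ.parts.map fun i => (qInt i)⁻¹).prod) * pPart Kq μ := by
    have hpos : ∀ i ∈ μ.parts, 0 < i := fun i hi => μ.parts_pos hi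
    rw [pPart]
    generalize μ.parts = s at hpos
    induction s using Multiset.induction with
    | empty => simp
    | cons a s ih =>
      simp only [Multiset.map_cons, Multiset.prod_cons, Multiset.card_cons]
      rw [map_mul φ, ih fun i hi => hpos i (Multiset.mem_cons_of_mem hi)]
      have ha : φ (p Kq a) = C (((1 - q) * qInt a)⁻¹) * p Kq a := by
        rw [← adams_inv_one_sub_q a (hpos a (Multiset.mem_cons_self a s))]
        exact aeval_X _ _
      rw [ha, pow_succ, mul_inv, mul_inv]
      simp only [map_mul]
      ring
  have hcard : μ.parts.card ≤ n := by
    have := Multiset.card_nsmul_le_sum (s := μ.parts) (a := 1) fun x hx => μ.parts_pos hx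
    rwa [μ.parts_sum, smul_eq_mul, mul_one] at this
  have h2 : (1 - q : Kq) ^ n * ((1 - q) ^ μ.parts.card)⁻¹ = (1 - q) ^ (n - μ.parts.card) := by
    rw [pow_sub₀ _ one_sub_q_ne_zero hcard]
  rw [map_mul φ, h1, algHom_C, ← h2, algebraMap_eq]
  simp only [map_mul]
  ring

/-- The inclusion of `Λ_ℚ` in `Λ_{ℚ(q)}`. -/
noncomputable def constSym : Sym ℚ →+* Sym Kq := MvPolynomial.map RatFunc.C

theorem constSym_p (k : ℕ) : constSym (p ℚ k) = p Kq k := map_X _ _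

theorem constSym_C (c : ℚ) : constSym (C c) = C (c : Kq) := by
  rw [constSym, map_C, eq_ratCast]

theorem constSym_mem_regularSym (f : Sym ℚ) : constSym f ∈ regularSym := by
  induction f using MvPolynomial.induction_on with
  | C x => rw [constSym, map_C]; exact C_mem_regularSym (const_mem_regularRing x)
  | add f₁ f₂ h₁ h₂ => rw [map_add]; exact add_mem h₁ h₂
  | mul_X f k hf =>
    rw [map_mul, constSym, map_X]
    exact mul_mem hf (X_mem_regularSym k)

theorem p_mem_regularSym (k : ℕ) : p Kq k ∈ regularSym := X_mem_regularSym _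

/-- The two contributions of order one have the same size: `1^n` gives `-n(n-1)/4` through
`[n]_q!/n!`, and `2 1^(n-2)` gives `n!/(2(n-2)!) * 1/2 = n(n-1)/4`. -/
theorem exists_H_eq (n : ℕ) (hn : 0 < n) : ∃ r ∈ regularSym,
    H n = constSym (p ℚ 1 ^ n) + C (1 - q) * constSym (firstOrder n (p ℚ 1) (p ℚ 2)) +
      C (1 - q) ^ 2 * r := by
  obtain rfl | ⟨n, rfl⟩ : n = 1 ∨ ∃ m, n = m + 2 := by
    rcases n with _ | _ | n
    · omega
    · exact Or.inl rfl
    · exact Or.inr ⟨n, rfl⟩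
  · refine ⟨0, zero_mem _, ?_⟩
    have hz : (default : Nat.Partition 1) = onesPartition 1 := Subsingleton.elim _ _
    rw [H_eq_sum, Fintype.sum_unique, hz, zee_onesPartition]
    simp [firstOrder, qFactorial, qInt, onesPartition, pPart, constSym_p]
  · obtain ⟨y, hy, hfac⟩ := exists_qFactorial_eq (n + 2)
    have hn0 : ((n + 2).factorial : Kq) ≠ 0 := by exact_mod_cast (n + 2).factorial_ne_zero
    have hn1 : (n.factorial : Kq) ≠ 0 := by exact_mod_cast n.factorial_ne_zero
    have hfs : ((n + 2).factorial : Kq) = (n + 2) * (n + 1) * n.factorial := by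
      rw [Nat.factorial_succ, Nat.factorial_succ]
      push_cast
      ring
    have hinv := inv_qInt_mem_regularRing two_pos
    have hq2 : qInt 2 = 1 + q := by simp [qInt, Finset.sum_range_succ]
    have hq0 : qInt 2 ≠ 0 := by
      intro h0
      obtain ⟨z, hz, h1⟩ := exists_qInt_eq 2
      have h2 := eval_add_one_sub_q_mul 2 (add_mem (neg_mem (one_mem _))
        (mul_mem one_sub_q_mem_regularRing hz))
      rw [show (RatFunc.C 2 : Kq) + (1 - q) * (-1 + (1 - q) * z) = qInt 2 by
        rw [h1, map_ofNat]; push_cast; ring, h0, RatFunc.eval_zero] at h2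
      norm_num at h2
    set κ : ℚ := ((n + 2 : ℕ) : ℚ) * ((n + 2 : ℕ) - 1) / 4 with hκ
    have hκ' : (κ : Kq) = (n + 2) * (n + 1) / 4 := by rw [hκ]; push_cast; ring
    obtain ⟨y₁, hy₁, h₁⟩ : ∃ y₁ ∈ regularRing,
        qFactorial (n + 2) * ((n + 2).factorial : Kq)⁻¹ = 1 - (1 - q) * κ + (1 - q) ^ 2 * y₁ := by
      refine ⟨y * ((n + 2).factorial : Kq)⁻¹, mul_mem hy ?_, ?_⟩
      · have := ratCast_mem_regularRing ((n + 2).factorial : ℚ)⁻¹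
        push_cast at this
        exact this
      · rw [hfac, hκ']
        field_simp
        push_cast
        ring
    obtain ⟨y₂, hy₂, h₂⟩ : ∃ y₂ ∈ regularRing,
        qFactorial (n + 2) * (1 - q) * ((2 * n.factorial : ℕ) : Kq)⁻¹ * (qInt 2)⁻¹ =
          (1 - q) * κ + (1 - q) ^ 2 * y₂ := by
      -- This uses `(n+2)!/(2 n!) = 2κ` and `2/[2]_q = 1 + (1-q)/[2]_q`, the latter because `2 -
      -- [2]_q = 1 - q`.
      refine ⟨κ * (qInt 2)⁻¹ + (-κ * (2 * κ) + (1 - q) * y * (2 * n.factorial : Kq)⁻¹) * (qInt 2)⁻¹,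
        ?_, ?_⟩
      · have := ratCast_mem_regularRing (2 * n.factorial : ℚ)⁻¹
        push_cast at this
        have hκm := ratCast_mem_regularRing κ
        exact add_mem (mul_mem hκm hinv) (mul_mem (add_mem (mul_mem (neg_mem hκm)
          (mul_mem (ofNat_mem _ 2) hκm))
          (mul_mem (mul_mem one_sub_q_mem_regularRing hy) this)) hinv)
      · rw [hfac, hκ', hfs]
        push_cast
        field_simp
        rw [hq2]
        ring
    refine ⟨C y₁ * p Kq 1 ^ (n + 2) + C y₂ * (p Kq 2 * p Kq 1 ^ n) +
      ∑ μ : (n + 2).Partition with μ.parts.card ≤ n,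
        C (qFactorial (n + 2) * (1 - q) ^ (n - μ.parts.card) * (zee μ : Kq)⁻¹ *
          (μ.parts.map fun i => (qInt i)⁻¹).prod) * pPart Kq μ, ?_, ?_⟩
    · refine add_mem (add_mem (mul_mem (C_mem_regularSym hy₁) (pow_mem (p_mem_regularSym 1) _))
        (mul_mem (C_mem_regularSym hy₂) (mul_mem (p_mem_regularSym 2)
          (pow_mem (p_mem_regularSym 1) _)))) (sum_mem fun μ _ => mul_mem (C_mem_regularSym ?_) ?_)
      · refine mul_mem (mul_mem (mul_mem (prod_mem fun i _ => qInt_mem_regularRing (i + 1))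
          (pow_mem one_sub_q_mem_regularRing _)) ?_) (multiset_prod_mem _ fun x hx => ?_)
        · have := ratCast_mem_regularRing (zee μ : ℚ)⁻¹
          push_cast at this
          exact this
        · obtain ⟨i, hi, rfl⟩ := Multiset.mem_map.1 hx
          exact inv_qInt_mem_regularRing (μ.parts_pos hi)
      · refine multiset_prod_mem _ fun x hx => ?_
        obtain ⟨i, _, rfl⟩ := Multiset.mem_map.1 hx
        exact p_mem_regularSym i
    · rw [H_eq_sum, sum_partition_add_two, zee_onesPartition, zee_twoOnesPartition]
      have e1 : (onesPartition (n + 2)).parts.card = n + 2 := by simp [onesPartition]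
      have e2 : (twoOnesPartition n).parts.card = n + 1 := by simp [twoOnesPartition]
      have e3 : ((onesPartition (n + 2)).parts.map fun i => (qInt i)⁻¹).prod = 1 := by
        simp [onesPartition, qInt]
      have e4 : ((twoOnesPartition n).parts.map fun i => (qInt i)⁻¹).prod = (qInt 2)⁻¹ := by
        simp [twoOnesPartition, qInt]
      have e5 : pPart Kq (onesPartition (n + 2)) = p Kq 1 ^ (n + 2) := by
        simp only [onesPartition, pPart, Multiset.map_replicate, Multiset.prod_replicate]
      have e6 : pPart Kq (twoOnesPartition n) = p Kq 2 * p Kq 1 ^ n := by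
        simp [twoOnesPartition, pPart]
      rw [e1, e2, e3, e4, e5, e6, Nat.sub_self, pow_zero, mul_one, mul_one,
        show n + 2 - (n + 1) = 1 by omega, pow_one, h₁, h₂, firstOrder, ← hκ, mul_add,
        Finset.mul_sum]
      have e7 : ∑ μ : (n + 2).Partition with μ.parts.card ≤ n,
          C (qFactorial (n + 2) * (1 - q) ^ (n + 2 - μ.parts.card) * (zee μ : Kq)⁻¹ *
            (μ.parts.map fun i => (qInt i)⁻¹).prod) * pPart Kq μ =
          ∑ μ : (n + 2).Partition with μ.parts.card ≤ n, C (1 - q) ^ 2 *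
            (C (qFactorial (n + 2) * (1 - q) ^ (n - μ.parts.card) * (zee μ : Kq)⁻¹ *
              (μ.parts.map fun i => (qInt i)⁻¹).prod) * pPart Kq μ) := by
        refine Finset.sum_congr rfl fun μ hμ => ?_
        have hc : n + 2 - μ.parts.card = n - μ.parts.card + 2 := by
          have := (Finset.mem_filter.1 hμ).2
          omega
        rw [hc, pow_add]
        simp only [map_mul, map_pow]
        ring
      rw [e7]
      simp only [map_mul, map_sub, map_add, map_pow, map_one, constSym_p, constSym_C,
        Nat.add_sub_cancel]
      ring

/-! ### Expansion of `H_b[H_a]` at `q = 1` to the first order -/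

/-- The expansion is carried out inside `S`, so the remainder stays regular. -/
theorem exists_add_pow_eq {R : Type*} [CommRing R] (S : Subring R) {x y : R} (hx : x ∈ S)
    (hy : y ∈ S) (n : ℕ) : ∃ k ∈ S, (x + y) ^ n = x ^ n + n * x ^ (n - 1) * y + k * y ^ 2 := by
  obtain ⟨k, hk⟩ := Polynomial.powAddExpansion (⟨x, hx⟩ : S) ⟨y, hy⟩ n
  exact ⟨k, k.2, by simpa using congrArg Subtype.val hk⟩

theorem adams_one (f : Sym Kq) : adams 1 f = f := by
  have h1 : adamsCoeff 1 = RingHom.id Kq := by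
    ext1 x
    rw [← RatFunc.num_div_denom x]
    rw [map_div₀, adamsCoeff_algebraMap, adamsCoeff_algebraMap, PNat.one_coe,
      Polynomial.expand_one, Polynomial.expand_one, RingHom.id_apply]
  rw [adams, h1]
  simp

theorem adamsCoeff_two_one_sub_q : adamsCoeff 2 (1 - q) = (1 - q) * (1 + q) := by
  rw [map_sub, map_one, adamsCoeff_q]
  change 1 - q ^ 2 = _
  ring

/-- In `H_b` the power sum `p_2` already comes with a factor `1 - q`, so only the constant term
`p_2^a` of `p_2[H_a]` matters. The first-order term of `H_a` enters through `H_a^b` alone. -/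
theorem exists_plethysm_H_H_eq (a b : ℕ) (ha : 0 < a) (hb : 0 < b) : ∃ r ∈ regularSym,
    plethysm (H b) (H a) = constSym (p ℚ 1 ^ (a * b)) +
      C (1 - q) * constSym (firstOrderComp b a (p ℚ 1) (p ℚ 2)) + C (1 - q) ^ 2 * r := by
  obtain ⟨ra, hra, hHa⟩ := exists_H_eq a ha
  obtain ⟨rb, hrb, hHb⟩ := exists_H_eq b hb
  have he : (C (1 - q) : Sym Kq) ∈ regularSym := C_mem_regularSym one_sub_q_mem_regularRing
  set e : Sym Kq := C (1 - q) with hedef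
  set W := constSym (firstOrder a (p ℚ 1) (p ℚ 2)) with hW
  have hWm : W ∈ regularSym := constSym_mem_regularSym _
  have hP : p Kq 1 ^ a ∈ regularSym := pow_mem (p_mem_regularSym 1) a
  have hQ : p Kq 2 ^ a ∈ regularSym := pow_mem (p_mem_regularSym 2) a
  set s := W + e * ra with hs
  have hsm : s ∈ regularSym := add_mem hWm (mul_mem he hra)
  have hHa1 : H a = p Kq 1 ^ a + e * s := by
    rw [hHa, map_pow, constSym_p, hs]
    ring
  have hHam : H a ∈ regularSym := by rw [hHa1]; exact add_mem hP (mul_mem he hsm)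
  obtain ⟨t, ht, hA2⟩ : ∃ t ∈ regularSym, adams 2 (H a) = p Kq 2 ^ a + e * t := by
    refine ⟨C (1 + q) * adams 2 s, mul_mem (C_mem_regularSym (add_mem (one_mem _)
      q_mem_regularRing)) (adams_mem_regularSym 2 hsm), ?_⟩
    -- The Adams operation acts on `q` too, but `1 - q^2` is still divisible by `1 - q`.
    have h1 : adams 2 e = e * C (1 + q) := by
      rw [hedef, adams, eval₂Hom_C, RingHom.comp_apply, adamsCoeff_two_one_sub_q, map_mul]
    have h2 : adams 2 (p Kq 1) = p Kq 2 := by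
      rw [adams, p, eval₂Hom_X', p]
      rfl
    rw [hHa1, map_add, map_mul, map_pow, h1, h2]
    ring
  obtain ⟨k₁, hk₁, h₁⟩ := exists_add_pow_eq regularSym hP (mul_mem he hsm) b
  obtain ⟨k₂, hk₂, h₂⟩ := exists_add_pow_eq regularSym hP (mul_mem he hsm) (b - 2)
  rw [← hHa1] at h₁ h₂
  set κ : Sym Kq := C (((b : ℚ) * (b - 1) / 4 : ℚ) : Kq) with hκ
  have hκm : κ ∈ regularSym := C_mem_regularSym (ratCast_mem_regularRing _)
  have hpl : plethysm (H b) (H a) = H a ^ b +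
      e * (κ * (adams 2 (H a) * H a ^ (b - 2) - H a ^ b)) + e ^ 2 * plethysm rb (H a) := by
    have hp1 : aeval (fun k => adams k (H a)) (p Kq 1) = H a := by
      rw [p, aeval_X]
      exact adams_one _
    have hp2 : aeval (fun k => adams k (H a)) (p Kq 2) = adams 2 (H a) := by
      rw [p, aeval_X]
      rfl
    have hC : ∀ c : Kq, aeval (fun k => adams k (H a)) (C c) = C c := fun c => algHom_C _ _
    rw [plethysm, hHb, firstOrder]
    simp only [map_mul, map_sub, map_add, map_pow, constSym_p, constSym_C, hp1, hp2, hC, hedef,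
      plethysm, hκ]
  set m₁ := b * (p Kq 1 ^ a) ^ (b - 1) * s + e * (k₁ * s ^ 2) with hm₁
  set m₂ := (b - 2 : ℕ) * (p Kq 1 ^ a) ^ (b - 2 - 1) * s + e * (k₂ * s ^ 2) with hm₂
  have hm₁m : m₁ ∈ regularSym := add_mem (mul_mem (mul_mem (natCast_mem _ _) (pow_mem hP _)) hsm)
    (mul_mem he (mul_mem hk₁ (pow_mem hsm 2)))
  have hm₂m : m₂ ∈ regularSym := add_mem (mul_mem (mul_mem (natCast_mem _ _) (pow_mem hP _)) hsm)
    (mul_mem he (mul_mem hk₂ (pow_mem hsm 2)))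
  have h₂' : H a ^ (b - 2) = (p Kq 1 ^ a) ^ (b - 2) + e * m₂ := by rw [h₂]; ring
  have h₁' : H a ^ b = (p Kq 1 ^ a) ^ b + e * m₁ := by rw [h₁]; ring
  refine ⟨b * (p Kq 1 ^ a) ^ (b - 1) * ra + k₁ * s ^ 2 +
    κ * (t * H a ^ (b - 2) + p Kq 2 ^ a * m₂ - m₁) + plethysm rb (H a), ?_, ?_⟩
  · exact add_mem (add_mem (add_mem (mul_mem (mul_mem (natCast_mem _ _) (pow_mem hP _)) hra)
      (mul_mem hk₁ (pow_mem hsm 2))) (mul_mem hκm (sub_mem (add_mem (mul_mem ht (pow_mem hHam _))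
        (mul_mem hQ hm₂m)) hm₁m))) (plethysm_mem_regularSym hrb hHam)
  · rw [hpl, firstOrderComp]
    simp only [map_mul, map_add, map_pow, constSym_p, map_natCast, ← hW]
    have hfo : constSym (firstOrder b (p ℚ 1 ^ a) (p ℚ 2 ^ a)) =
        κ * (p Kq 2 ^ a * (p Kq 1 ^ a) ^ (b - 2) - (p Kq 1 ^ a) ^ b) := by
      rw [firstOrder]
      simp only [map_mul, map_sub, map_pow, constSym_p, constSym_C, hκ]
    rw [hfo, pow_mul, pow_mul, hA2]
    linear_combination h₁ + e * κ * (p Kq 2 ^ a * h₂' - h₁') +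
      e * (b * (p Kq 1 ^ a) ^ (b - 1)) * hs

/-- The constant terms `p_1^(ab)` of the two plethysms cancel, so the division by `1 - q` leaves the
difference of the first-order terms. -/
theorem exists_F_eq (a b : ℕ) (ha : 0 < a) (hb : 0 < b) : ∃ r ∈ regularSym,
    F a b = constSym (FOne a b (p ℚ 1) (p ℚ 2)) + C (1 - q) * r := by
  obtain ⟨r, hr, h₁⟩ := exists_plethysm_H_H_eq a b ha hb
  obtain ⟨r', hr', h₂⟩ := exists_plethysm_H_H_eq b a hb ha
  refine ⟨r - r', sub_mem hr hr', ?_⟩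
  have hc : (C (1 - q)⁻¹ * C (1 - q) : Sym Kq) = 1 := by
    rw [← C_mul, inv_mul_cancel₀ one_sub_q_ne_zero, C_1]
  rw [F, h₁, h₂, FOne, map_sub constSym, mul_comm b a]
  linear_combination (constSym (firstOrderComp b a (p ℚ 1) (p ℚ 2)) -
    constSym (firstOrderComp a b (p ℚ 1) (p ℚ 2)) + C (1 - q) * (r - r')) * hc

theorem F_regularAtOne_and_atOne (a b : ℕ) (ha : 0 < a) (hb : 0 < b) :
    RegularAtOne (F a b) ∧ atOne (F a b) = FOne a b (h ℚ 1) (2 * h ℚ 2 - h ℚ 1 ^ 2) := by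
  obtain ⟨r, hr, he⟩ := exists_F_eq a b ha hb
  rw [← p_two, h_one]
  exact regularAtOne_and_atOne_eq hr he

end SymmFun

theorem proposition3p3 (a b : ℕ) (ha : 0 < a) (hab : a < b) (lam : YoungDiagram) :
    SymmFun.RegularAtOne (SymmFun.F a b) ∧ SymmFun.RegularAtOne (SymmFun.F a (b + 1)) ∧
      ∃ n : ℕ,
        SymmFun.scalar
            (SymmFun.bar (SymmFun.atOne (SymmFun.F a (b + 1))) -
              SymmFun.bar (SymmFun.atOne (SymmFun.F a b)))
            (SymmFun.schur ℚ lam) = (n : ℚ) := by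
  obtain ⟨h₁, e₁⟩ := SymmFun.F_regularAtOne_and_atOne a b ha (ha.trans hab)
  obtain ⟨h₂, e₂⟩ := SymmFun.F_regularAtOne_and_atOne a (b + 1) ha b.succ_pos
  refine ⟨h₁, h₂, ?_⟩
  rw [e₁, e₂]
  exact SymmFun.exists_scalar_schur_eq (SymmFun.bar_FOne_succ_sub_mem a b ha hab.le) lam
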